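/- **Model.** Fix $0<p<1$, $0<p_r<1$, $\delta\ge 2$, $P_{\max}>0$, $\alpha<1$, and put $q=1-p$, $d_F=\log(4/q)/\log 2$, $d_r=2\log(2/(1-p_r))/\log 2$. Assume $d_F>3$ and $d_r<d_F-1$. The streets of level $l\ge 0$ are the vertical segments $\{b2^{-(l+1)}\}\times[0,1]$ and the horizontal segments $[0,1]\times\{b2^{-(l+1)}\}$, $b=1,3,\dots,2^{l+1}-1$; the two streets of level $0$ form the central cross. For $n\ge1$, the hyperfractal network with $n$ nodes consists of $n$ independent mobile nodes, whose common law has one-dimensional density $(p/2)(q/2)^l$ on each street of level $l$, and of relays: independently of the nodes and of each other, each crossing of a vertical street of level $h$ and a horizontal street of level $v$ carries a Poisson number of points with mean $n\,p_r^2\left(\frac{1-p_r}{2}\right)^{h+v}$, and there is a relay at the crossing if and only if this number is at least $1$. A transmission (hop) goes along a street from one site (mobile node or relay) to another site on the same street such that no mobile node lies strictly between them. It has power $P_{\max}/m^\delta$, where $m$ is the number of mobile nodes on that street ($P_{\max}$ if $m=0$). A path $T$ is a finite sequence of sites joined by successive hops; its length $|T|$ is its number of sites, its accumulated energy is the sum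 of the powers of its transmissions, and its maximum power is their maximum. Either of these two quantities may be chosen as the cost of a path, with reference budget $$b_n=n^{(1-\delta)(1-\alpha)}P_{\max}\ \text{ for the accumulated energy,}\qquad b_n=n^{-\delta(1-\alpha)}P_{\max}\ \text{ for the maximum power.}$$ Let $B_n$ be a budget ($E_n$ in the first case, $M_n$ in the second) of exact order $b_n$: $B_n=O(b_n)$ and $B_n\ge c_0b_n$ for some $c_0>0$ and all large $n$. Let $G$ be the set of the mobile nodes that are connected to a point of the central cross by a path of cost at most $B_n$ with at most one relay ($G=G_1(n,E_n)$, respectively $G=G_1'(n,M_n)$). Call $(i,j)\in G\times G$ joined if there is a path from $i$ to $j$ of cost at most $B_n$, and let $r_{ij}$ then be the least length of such a path. If every node transmits at rate $C>0$, the throughput capacity is $$\zeta(n)=\frac{n^2\sum_{i\in G}C}{\sum_{(i,j)\ \text{joined}}r_{ij}}$$ (with the convention $\zeta(n)=0$ if $G=\emptyset$). **Corollary (throughput capacity lower bound).** For either choice of the cost, $\zeta(n)=\Omega\big(C\,n^{\alpha/(d_F-1)}\big)$, with probability tending to $1$ and in mean: there is a constant $c>0$, not depending on $C$ or $n$, such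 that for every $C>0$ $$\lim_{n\to\infty}\mathbb P\Big(\zeta(n)<c\,C\,n^{\alpha/(d_F-1)}\Big)=0\qquad\text{and}\qquad \mathbb E[\zeta(n)]\ge c\,C\,n^{\alpha/(d_F-1)}\ \text{ for all large } n.$$ Moreover, if $\alpha>0$, then almost all pairs are joined: for every $\varepsilon>0$, the probability that fewer than $(1-\varepsilon)n^2$ ordered pairs are joined tends to $0$. -/

import Mathlib

open MeasureTheory ProbabilityTheory Filter Topology Asymptotics

noncomputable section

namespace Hyperfractal

/-! ### The street map -/

/-- A dyadic line: a level `l` together with an index `k < 2 ^ l`; it encodes the odd integer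
`b = 2 k + 1 ∈ {1, 3, …, 2 ^ (l + 1) - 1}`. -/
abbrev Line := Σ l : ℕ, Fin (2 ^ l)

/-- The coordinate `b 2^{-(l+1)}` of a dyadic line. -/
def Line.offset (a : Line) : ℝ := (2 * (a.2 : ℕ) + 1) / 2 ^ (a.1 + 1)

/-- A street of the map: `Sum.inl a` is the vertical street `{offset a} × [0, 1]` and
`Sum.inr a` the horizontal street `[0, 1] × {offset a}`. -/
abbrev Street := Line ⊕ Line

/-- The level of a street. -/
def Street.level : Street → ℕ
  | Sum.inl a => a.1
  | Sum.inr a => a.1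

/-- The point of a street with coordinate `t` along the street. -/
def Street.point : Street → ℝ → ℝ × ℝ
  | Sum.inl a, t => (a.offset, t)
  | Sum.inr a, t => (t, a.offset)

/-- The street as a subset of the unit square. -/
def Street.carrier (s : Street) : Set (ℝ × ℝ) := s.point '' Set.Icc 0 1

/-- The union of the streets of level `l`. -/
def support (l : ℕ) : Set (ℝ × ℝ) := ⋃ (s : Street) (_ : s.level = l), s.carrier

/-- A crossing: its first component is the vertical street and its second component
the horizontal street. -/
abbrev Crossing := Line × Line

/-- The location of a crossing. -/
def Crossing.point (c : Crossing) : ℝ × ℝ := (c.1.offset, c.2.offset)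

/-! ### Mobile nodes and relays -/

/-- The law of the position of one mobile node: one-dimensional density `(p / 2) (q / 2) ^ l`,
with `q = 1 - p`, on every street of level `l`. -/
def nodeLaw (p : ℝ) : Measure (ℝ × ℝ) :=
  Measure.sum fun s : Street =>
    ENNReal.ofReal (p / 2 * ((1 - p) / 2) ^ s.level) •
      (volume.restrict (Set.Icc (0 : ℝ) 1)).map s.point

/-- The intensity `ρ p_r² ((1 - p_r) / 2) ^ (h + v)` of the auxiliary Poisson process at a crossing
of streets of levels `h` and `v`. -/
def relayIntensity (pr ρ : ℝ) (c : Crossing) : ℝ :=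
  ρ * pr ^ 2 * ((1 - pr) / 2) ^ (c.1.1 + c.2.1)

/-- A configuration: the positions of the `n` mobile nodes, and at every crossing the number
of points of the auxiliary Poisson process. -/
abbrev Config (n : ℕ) := (Fin n → ℝ × ℝ) × (Crossing → ℕ)

/-- The law of the hyperfractal network with `n` mobile nodes: the nodes are independent with
law `nodeLaw p`; independently of them, the auxiliary process has independent Poisson
multiplicities at the crossings, with total intensity `ρ = n`. -/
def networkLaw (p pr : ℝ) (n : ℕ) : Measure (Config n) :=
  (Measure.pi fun _ : Fin n => nodeLaw p).prod
    (Measure.infinitePi fun c : Crossing => poissonMeasure (relayIntensity pr n c).toNNReal)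

/-- The fractal dimension `d_F` of the mobile nodes, `(1 / 2) ^ d_F = q / 4`. -/
def nodeDim (p : ℝ) : ℝ := Real.log (4 / (1 - p)) / Real.log 2

/-- The fractal dimension `d_r` of the relays. -/
def relayDim (pr : ℝ) : ℝ := 2 * (Real.log (2 / (1 - pr)) / Real.log 2)

/-! ### Routes -/

/-- The possible members of a routing path: mobile nodes, and relays at crossings. -/
inductive Site (n : ℕ) : Type
  | mobile (i : Fin n) : Site n
  | relay (c : Crossing) : Site n

variable {n : ℕ}

/-- The location of a site. -/
def Site.pos (ω : Config n) : Site n → ℝ × ℝ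
  | Site.mobile i => ω.1 i
  | Site.relay c => c.point

/-- All mobile nodes are present; a relay is present at a crossing if and only if the auxiliary
process has at least one point there. -/
def Site.Present (ω : Config n) : Site n → Prop
  | Site.mobile _ => True
  | Site.relay c => 0 < ω.2 c

/-- `1` for a relay and `0` for a mobile node. -/
def Site.relayCount : Site n → ℕ
  | Site.mobile _ => 0
  | Site.relay _ => 1

/-- Nearest neighbour transmission along the street `s`: both ends are on `s`, and there is no
mobile node strictly between them. -/
def Hop (ω : Config n) (s : Street) (a b : Site n) : Prop :=
  a ≠ b ∧ a.Present ω ∧ b.Present ω ∧ a.pos ω ∈ s.carrier ∧ b.pos ω ∈ s.carrier ∧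
    ∀ i : Fin n, ω.1 i ∉ openSegment ℝ (a.pos ω) (b.pos ω)

/-- Routing paths: finite sequences of sites in which each site transmits to the next one
along a street. -/
inductive Route (ω : Config n) : Site n → Site n → Type
  | nil (a : Site n) : Route ω a a
  | cons {a b c : Site n} (s : Street) (h : Hop ω s a b) (T : Route ω b c) : Route ω a c

/-- The number of mobile nodes on a street. -/
def streetCount (ω : Config n) (s : Street) : ℕ := {i : Fin n | ω.1 i ∈ s.carrier}.ncard

/-- The nominal power `P_max / m ^ δ` of a transmission along a street which carries `m ≥ 1`
mobile nodes. On a street without mobile nodes (where only relays transmit) it is `P_max`. -/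
def power (δ Pmax : ℝ) (ω : Config n) (s : Street) : ℝ :=
  Pmax / (max (streetCount ω s) 1 : ℕ) ^ δ

/-- The length `|T|` of a path: the number of its sites. -/
def Route.length {ω : Config n} : {a b : Site n} → Route ω a b → ℕ
  | _, _, Route.nil _ => 1
  | _, _, Route.cons _ _ T => T.length + 1

/-- The number of relays of a path (with multiplicity). -/
def Route.relays {ω : Config n} : {a b : Site n} → Route ω a b → ℕ
  | _, _, Route.nil a => a.relayCount
  | a, _, Route.cons _ _ T => a.relayCount + T.relays

/-- The accumulated energy of a path: the sum of the powers of its transmissions. A relay has one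
radio interface for each of its two streets and spends the power of the street on which it
transmits. -/
def Route.energy (δ Pmax : ℝ) {ω : Config n} : {a b : Site n} → Route ω a b → ℝ
  | _, _, Route.nil _ => 0
  | _, _, Route.cons s _ T => power δ Pmax ω s + T.energy δ Pmax

/-- The maximum power of a path: the maximum of the powers of its transmissions. -/
def Route.maxPower (δ Pmax : ℝ) {ω : Config n} : {a b : Site n} → Route ω a b → ℝ
  | _, _, Route.nil _ => 0
  | _, _, Route.cons s _ T => max (power δ Pmax ω s) (T.maxPower δ Pmax)

/-- The two ways in which the energy of a path is constrained. -/
inductive Criterion : Type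
  | accumulated : Criterion
  | maximum : Criterion

/-- The quantity of a path which is constrained. -/
def Route.cost (δ Pmax : ℝ) {ω : Config n} {a b : Site n} (T : Route ω a b) : Criterion → ℝ
  | Criterion.accumulated => T.energy δ Pmax
  | Criterion.maximum => T.maxPower δ Pmax

/-! ### Giant component, hop counts, throughput -/

/-- `G_k(n, B)` (accumulated energy) or `G'_k(n, B)` (maximum power): the mobile nodes which are
connected to the central cross by a path through at most `k` relays within the budget `B`. -/
def component (δ Pmax : ℝ) (κ : Criterion) (k : ℕ) (B : ℝ) (ω : Config n) : Set (Fin n) :=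
  {i | ∃ (b : Site n) (T : Route ω (Site.mobile i) b),
    b.pos ω ∈ support 0 ∧ T.relays ≤ k ∧ T.cost δ Pmax κ ≤ B}

/-- The pairs of nodes of `G_1(n, B)` (or `G'_1(n, B)`) which are joined by a path within
the budget `B`. -/
def joinedPairs (δ Pmax : ℝ) (κ : Criterion) (B : ℝ) (ω : Config n) : Set (Fin n × Fin n) :=
  {x | x.1 ∈ component δ Pmax κ 1 B ω ∧ x.2 ∈ component δ Pmax κ 1 B ω ∧
    ∃ T : Route ω (Site.mobile x.1) (Site.mobile x.2), T.cost δ Pmax κ ≤ B}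

/-- `r_ij`: the length of a shortest path from `i` to `j` within the budget `B`
(used only for joined pairs). -/
def hopCount (δ Pmax : ℝ) (κ : Criterion) (B : ℝ) (ω : Config n) (i j : Fin n) : ℕ :=
  sInf {d | ∃ T : Route ω (Site.mobile i) (Site.mobile j), T.cost δ Pmax κ ≤ B ∧ T.length = d}

open Classical in
/-- The throughput capacity `ζ(n) = n² ∑_{i ∈ G} w_i / ∑_{i, j ∈ G} r_ij` for the transmission
rates `w_i`, with `G = G_1(n, B)` or `G'_1(n, B)` and with routing within the budget `B`. -/
def throughput (δ Pmax : ℝ) (κ : Criterion) (B : ℝ) (w : Fin n → ℝ) (ω : Config n) : ℝ :=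
  (n : ℝ) ^ 2 * (∑ i with i ∈ component δ Pmax κ 1 B ω, w i) /
    ∑ x with x ∈ joinedPairs δ Pmax κ B ω, (hopCount δ Pmax κ B ω x.1 x.2 : ℝ)

/-- The order of magnitude of the budget: `n ^ ((1 - δ) (1 - α)) P_max` for the accumulated energy
and `n ^ (- δ (1 - α)) P_max` for the maximum power. -/
def budgetOrder (δ Pmax α : ℝ) : Criterion → ℕ → ℝ
  | Criterion.accumulated, n => (n : ℝ) ^ ((1 - δ) * (1 - α)) * Pmax
  | Criterion.maximum, n => (n : ℝ) ^ (-δ * (1 - α)) * Pmax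

end Hyperfractal

end

/-! Put q = 1 - p and x = q/2, so that x⁻¹ = 2^(d_F - 1). A street of level l carries about n x^l
nodes. Choose the level L with x^L of order n^(-α). Then 2^L has order n^(α/(d_F - 1)), and every
street of level at most L carries at least M = K n^(1-α) nodes. Walking along such a street costs at
most 2 Pmax M^(1-δ) in accumulated energy, and each hop has power at most Pmax M^(-δ). For large K,
five such walks fit in the budget (`exists_affordable`).

The streets of level L form a grid of mesh 2^(-L). A node on a street of level at most L reaches
this grid within one dyadic piece of its own street, and two points of the grid are joined along at
most three streets of level L. Each of these five walks meets O(n/2^L) nodes, because a piece of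
length 2^(-L) and a whole street of level L both have mass at most 2^(-L). This gives O(n/2^L) hops
(`WellSpread.linked_mobile`). The relays at the turns exist because d_r < d_F - 1 makes their
intensity at least p_r² n x^L, of order at least n^(1-α).

Nodes off the streets of level at most L have total mass q^(L+1). Since d_F > 3 means q < 1/2, this
is much smaller than 2^(-L). A shortest route visits each site at most once, so a pair with such a
node has at most n + 4n hops (`hopCount_le_of_encard_relays`). These pairs add only O(n²) · n/2^L to
the sum of the hop counts, which is therefore O(n³/2^L). The component contains the nodes on the
central cross, a positive fraction of all nodes, so the throughput is at least of order C 2^L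
(`Typical.le_throughput`). If α ≤ 0, the crude bound of 5n hops per pair already suffices.

The required configurations are typical by Chernoff bounds and a union bound over O(4^L) events
(`networkLaw_not_wellSpread`, `networkLaw_encard_relays`, `exists_typical`). The bound in mean
follows because the good event eventually has probability at least 1/2. -/

namespace Hyperfractal

section Routes

variable {n : ℕ} {ω : Config n}

/-! ### Concatenating and shortening routes -/

namespace Route

/-- Concatenation of routes. -/
def append {a b c : Site n} : Route ω a b → Route ω b c → Route ω a c
  | nil _, T' => T'
  | cons s h T, T' => cons s h (T.append T')

/-- The list of the sites of a route. -/
def sites {a b : Site n} : Route ω a b → List (Site n)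
  | nil a => [a]
  | cons (a := a) _ _ T => a :: T.sites

lemma one_le_length {a b : Site n} (T : Route ω a b) : 1 ≤ T.length := by
  cases T <;> simp [length]

lemma length_append {a b c : Site n} (T : Route ω a b) (T' : Route ω b c) :
    (T.append T').length + 1 = T.length + T'.length := by
  induction T with
  | nil a => simp [append, length, add_comm]
  | cons s h T ih => simp only [append, length]; have := ih T'; omega

lemma energy_append (δ Pmax : ℝ) {a b c : Site n} (T : Route ω a b) (T' : Route ω b c) :
    (T.append T').energy δ Pmax = T.energy δ Pmax + T'.energy δ Pmax := by
  induction T with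
  | nil a => simp [append, energy]
  | cons s h T ih => simp only [append, energy, ih, add_assoc]

lemma maxPower_append_le {δ Pmax P : ℝ} {a b c : Site n} {T : Route ω a b} {T' : Route ω b c}
    (hT : T.maxPower δ Pmax ≤ P) (hT' : T'.maxPower δ Pmax ≤ P) :
    (T.append T').maxPower δ Pmax ≤ P := by
  induction T with
  | nil a => simpa [append]
  | cons s h T ih =>
    simp only [append, maxPower, max_le_iff] at hT ⊢
    exact ⟨hT.1, ih hT.2 hT'⟩

lemma relays_append (a b c : Site n) (T : Route ω a b) (T' : Route ω b c) :
    (T.append T').relays + b.relayCount = T.relays + T'.relays := by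
  induction T with
  | nil a => simp [append, relays, add_comm]
  | cons s h T ih => simp only [append, relays]; have := ih T'; omega

lemma length_sites {a b : Site n} (T : Route ω a b) : T.sites.length = T.length := by
  induction T with
  | nil a => simp [sites, length]
  | cons s h T ih => simp [sites, length, ih]

lemma present_of_mem_sites {a b : Site n} (T : Route ω a b) (ha : a.Present ω) :
    ∀ c ∈ T.sites, c.Present ω := by
  induction T with
  | nil a => simpa [sites]
  | cons s h T ih => simpa [sites, ha] using ih h.2.2.1

end Route

lemma power_nonneg {Pmax : ℝ} (hP : 0 ≤ Pmax) (δ : ℝ) (ω : Config n) (s : Street) :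
    0 ≤ power δ Pmax ω s := by
  unfold power; positivity

namespace Route

lemma cost_le_cost_cons {δ Pmax : ℝ} (hP : 0 ≤ Pmax) (κ : Criterion) {a b c : Site n}
    (s : Street) (h : Hop ω s a b) (T : Route ω b c) :
    T.cost δ Pmax κ ≤ (cons s h T).cost δ Pmax κ := by
  have := power_nonneg hP δ ω s
  cases κ
  · simpa [cost, energy]
  · simp [cost, maxPower]

lemma cost_cons_le_cost_cons {δ Pmax : ℝ} (κ : Criterion) {a b c : Site n}
    (s : Street) (h : Hop ω s a b) {T T' : Route ω b c}
    (hT : T'.cost δ Pmax κ ≤ T.cost δ Pmax κ) :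
    (cons s h T').cost δ Pmax κ ≤ (cons s h T).cost δ Pmax κ := by
  cases κ
  · simpa [cost, energy] using hT
  · exact max_le_max le_rfl hT

/-- A route can be entered at any of its sites. -/
lemma exists_suffix {δ Pmax : ℝ} (hP : 0 ≤ Pmax) (κ : Criterion) {a b : Site n}
    (T : Route ω a b) {c : Site n} (hc : c ∈ T.sites) :
    ∃ T' : Route ω c b, T'.cost δ Pmax κ ≤ T.cost δ Pmax κ ∧ T'.sites <:+ T.sites := by
  induction T with
  | nil a =>
    obtain rfl : c = a := by simpa [sites] using hc
    exact ⟨nil c, le_rfl, List.suffix_rfl⟩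
  | @cons a b d s h T ih =>
    rcases List.mem_cons.1 (show c ∈ a :: T.sites from hc) with rfl | hc
    · exact ⟨cons s h T, le_rfl, List.suffix_rfl⟩
    · obtain ⟨T', h1, h2⟩ := ih hc
      exact ⟨T', h1.trans (cost_le_cost_cons hP κ s h T), h2.trans (List.suffix_cons _ _)⟩

/-- Cutting the loops of a route does not increase its cost. -/
lemma exists_nodup {δ Pmax : ℝ} (hP : 0 ≤ Pmax) (κ : Criterion) {a b : Site n}
    (T : Route ω a b) :
    ∃ T' : Route ω a b, T'.cost δ Pmax κ ≤ T.cost δ Pmax κ ∧ T'.sites.Nodup := by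
  induction T with
  | nil a => exact ⟨nil a, le_rfl, by simp [sites]⟩
  | @cons a b d s h T ih =>
    obtain ⟨T', h1, h2⟩ := ih
    have h3 := (cost_cons_le_cost_cons κ s h h1)
    -- If `a` reappears in the shortened tail, the route starts from that occurrence instead.
    by_cases ha : a ∈ T'.sites
    · obtain ⟨T'', h4, h5⟩ := T'.exists_suffix hP κ ha
      exact ⟨T'', h4.trans ((cost_le_cost_cons hP κ s h T').trans h3), h2.sublist h5.sublist⟩
    · exact ⟨cons s h T', h3, List.nodup_cons.2 ⟨ha, h2⟩⟩

end Route

/-- A shortest path within the budget visits every site at most once. -/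
lemma hopCount_le_of_encard_relays {δ Pmax : ℝ} (hP : 0 ≤ Pmax) {κ : Criterion} {B : ℝ}
    {i j : Fin n} {m : ℕ} (hm : {c | 0 < ω.2 c}.encard ≤ m)
    (hT : ∃ T : Route ω (Site.mobile i) (Site.mobile j), T.cost δ Pmax κ ≤ B) :
    hopCount δ Pmax κ B ω i j ≤ n + m := by
  classical
  obtain ⟨T, hT⟩ := hT
  obtain ⟨T', h1, h2⟩ := T.exists_nodup (δ := δ) hP κ
  have hfin : {c | 0 < ω.2 c}.Finite := Set.finite_of_encard_le_coe hm
  have hlen : hopCount δ Pmax κ B ω i j ≤ T'.length := Nat.sInf_le ⟨T', h1.trans hT, rfl⟩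
  refine hlen.trans ?_
  rw [← T'.length_sites, ← List.toFinset_card_of_nodup h2]
  have hsub : T'.sites.toFinset ⊆
      Finset.univ.image Site.mobile ∪ hfin.toFinset.image Site.relay := by
    intro x hx
    have := T'.present_of_mem_sites (by trivial) x (List.mem_toFinset.1 hx)
    cases x with
    | mobile k => simp
    | relay c => simpa [Site.Present] using this
  refine (Finset.card_le_card hsub).trans ((Finset.card_union_le _ _).trans ?_)
  refine add_le_add (Finset.card_image_le.trans (by simp)) (Finset.card_image_le.trans ?_)
  rw [← Set.ncard_eq_toFinset_card _ hfin]
  rw [← hfin.cast_ncard_eq] at hm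
  exact_mod_cast hm

/-! ### Walking along a street -/

lemma Street.point_injective (s : Street) : Function.Injective s.point := by
  intro t t' h
  cases s <;> simpa [Street.point] using h

lemma Street.image_openSegment (s : Street) (t t' : ℝ) :
    openSegment ℝ (s.point t) (s.point t') = s.point '' openSegment ℝ t t' := by
  have key : ∀ u v : ℝ, u + v = 1 → u • s.point t + v • s.point t' = s.point (u • t + v • t') := by
    intro u v huv
    cases s <;> simp [Street.point, ← add_mul, huv]
  ext x
  constructor
  · rintro ⟨u, v, hu, hv, huv, rfl⟩
    exact ⟨_, ⟨u, v, hu, hv, huv, rfl⟩, (key u v huv).symm⟩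
  · rintro ⟨_, ⟨u, v, hu, hv, huv, rfl⟩, rfl⟩
    exact ⟨u, v, hu, hv, huv, key u v huv⟩

/-- The number of mobile nodes in a subset of the map. -/
noncomputable def nodeCount (ω : Config n) (A : Set (ℝ × ℝ)) : ℕ := {i : Fin n | ω.1 i ∈ A}.ncard

lemma nodeCount_mono {A A' : Set (ℝ × ℝ)} (h : A ⊆ A') : nodeCount ω A ≤ nodeCount ω A' :=
  Set.ncard_le_ncard (fun _ hi => h hi) (Set.toFinite _)

lemma disjoint_openSegment_split {t u t' : ℝ} (h : t ≠ t') (hu : u ∈ openSegment ℝ t t') :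
    t ≠ u ∧ u ≠ t' ∧ openSegment ℝ t u ∪ openSegment ℝ u t' ⊆ openSegment ℝ t t' \ {u} ∧
      Disjoint (openSegment ℝ t u) (openSegment ℝ u t') := by
  wlog hlt : t < t' generalizing t t'
  · rw [openSegment_symm] at hu
    have h1 := this h.symm hu (lt_of_le_of_ne (le_of_not_gt hlt) h.symm)
    rw [openSegment_symm ℝ t u, openSegment_symm ℝ u t', openSegment_symm ℝ t t', Set.union_comm,
      disjoint_comm]
    exact ⟨h1.2.1.symm, h1.1.symm, h1.2.2.1, h1.2.2.2⟩
  rw [openSegment_eq_Ioo hlt] at hu ⊢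
  rw [openSegment_eq_Ioo hu.1, openSegment_eq_Ioo hu.2]
  refine ⟨hu.1.ne, hu.2.ne, ?_, ?_⟩
  · rintro x (hx | hx)
    · exact ⟨⟨hx.1, hx.2.trans hu.2⟩, hx.2.ne⟩
    · exact ⟨⟨hu.1.trans hx.1, hx.2⟩, hx.1.ne'⟩
  · exact Set.disjoint_left.2 fun x hx hx' => lt_asymm hx.2 hx'.1

lemma openSegment_subset_Icc {t t' : ℝ} (ht : t ∈ Set.Icc (0 : ℝ) 1) (ht' : t' ∈ Set.Icc (0 : ℝ) 1) :
    openSegment ℝ t t' ⊆ Set.Icc (0 : ℝ) 1 :=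
  (convex_Icc (0 : ℝ) 1).openSegment_subset ht ht'

/-- Along a street, one can walk from one site to another through the mobile nodes in between. -/
lemma exists_walk {δ Pmax : ℝ} (hP : 0 ≤ Pmax) (s : Street) {a b : Site n} {t t' : ℝ}
    (ha : a.Present ω) (hb : b.Present ω) (hat : a.pos ω = s.point t) (hbt : b.pos ω = s.point t')
    (ht : t ∈ Set.Icc (0 : ℝ) 1) (ht' : t' ∈ Set.Icc (0 : ℝ) 1) (hne : t ≠ t') :
    ∃ T : Route ω a b, T.length ≤ nodeCount ω (s.point '' openSegment ℝ t t') + 2 ∧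
      T.energy δ Pmax + power δ Pmax ω s = T.length * power δ Pmax ω s ∧
      T.maxPower δ Pmax ≤ power δ Pmax ω s ∧ T.relays = a.relayCount + b.relayCount := by
  -- Any node in the open segment splits it into two segments with fewer nodes; other nodes at the
  -- same position lie in neither. The energy is (length - 1) times the power, stated without
  -- subtraction.
  induction hN : nodeCount ω (s.point '' openSegment ℝ t t') using Nat.strong_induction_on
    generalizing a b t t' with
  | _ N ih =>
  by_cases h : ∃ i, ω.1 i ∈ s.point '' openSegment ℝ t t'
  · obtain ⟨i, u, hu, hiu⟩ := h
    obtain ⟨h1, h2, h3, h4⟩ := disjoint_openSegment_split hne hu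
    have hcount : nodeCount ω (s.point '' openSegment ℝ t u) +
        nodeCount ω (s.point '' openSegment ℝ u t') + 1 ≤ N := by
      have hd : Disjoint {k : Fin n | ω.1 k ∈ s.point '' openSegment ℝ t u}
          {k : Fin n | ω.1 k ∈ s.point '' openSegment ℝ u t'} := by
        have := (Set.disjoint_image_iff s.point_injective).2 h4
        exact Set.disjoint_left.2 fun k hk hk' => Set.disjoint_left.1 this hk hk'
      rw [nodeCount, nodeCount, ← Set.ncard_union_eq hd (Set.toFinite _) (Set.toFinite _), ← hN,
        nodeCount, ← Set.ncard_insert_of_notMem (a := i)]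
      · refine Set.ncard_le_ncard ?_ (Set.toFinite _)
        rintro k (rfl | hk | hk)
        · exact ⟨u, hu, hiu⟩
        · exact Set.image_mono (fun x hx => (h3 (Or.inl hx)).1) hk
        · exact Set.image_mono (fun x hx => (h3 (Or.inr hx)).1) hk
      · have hmem : ω.1 i ∉ s.point '' (openSegment ℝ t u ∪ openSegment ℝ u t') := by
          rintro ⟨v, hv, hvi⟩
          exact (h3 hv).2 (s.point_injective (hvi.trans hiu.symm))
        rw [Set.image_union] at hmem
        exact hmem
    have hu01 := openSegment_subset_Icc ht ht' hu
    obtain ⟨T₁, l₁, e₁, m₁, r₁⟩ := ih _ (by omega) (a := a) (b := Site.mobile i) ha trivial hat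
      hiu.symm ht hu01 h1 rfl
    obtain ⟨T₂, l₂, e₂, m₂, r₂⟩ := ih _ (by omega) (a := Site.mobile i) (b := b) trivial hb
      hiu.symm hbt hu01 ht' h2 rfl
    have hl := T₁.length_append T₂
    refine ⟨T₁.append T₂, by omega, ?_, Route.maxPower_append_le m₁ m₂, ?_⟩
    · have hl' : ((T₁.append T₂).length : ℝ) = T₁.length + T₂.length - 1 := by
        rw [eq_sub_iff_add_eq]; exact_mod_cast hl
      rw [Route.energy_append, hl']
      linear_combination e₁ + e₂
    · have := Route.relays_append _ _ _ T₁ T₂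
      have h0 : (Site.mobile i : Site n).relayCount = 0 := rfl
      omega
  · have hop : Hop ω s a b := by
      refine ⟨?_, ha, hb, ⟨t, ht, hat.symm⟩, ⟨t', ht', hbt.symm⟩, ?_⟩
      · rintro rfl
        exact hne (s.point_injective (hat.symm.trans hbt))
      · rw [hat, hbt, s.image_openSegment]
        exact fun i hi => h ⟨i, hi⟩
    refine ⟨.cons s hop (.nil b), by simp [Route.length], ?_, ?_, by simp [Route.relays]⟩
    · simp only [Route.energy, Route.length]; push_cast; ring
    · simpa [Route.maxPower] using power_nonneg hP δ ω s

lemma power_le {δ Pmax M : ℝ} (hP : 0 ≤ Pmax) (hδ : 0 ≤ δ) (hM : 0 < M) {s : Street}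
    (hs : M ≤ streetCount ω s) : power δ Pmax ω s ≤ Pmax * M ^ (-δ) := by
  have h1 : M ≤ (max (streetCount ω s) 1 : ℕ) := hs.trans (by exact_mod_cast le_max_left _ _)
  rw [power, Real.rpow_neg hM.le, ← div_eq_mul_inv]
  gcongr

/-- A walk past all m nodes of a street has at most m + 1 hops, and (m + 1) m^(-δ) ≤ 2 m^(1-δ)
decreases in m. A lower bound on the population thus bounds the energy of any walk along the street.
-/
lemma streetCount_mul_power_le {δ Pmax M : ℝ} (hP : 0 ≤ Pmax) (hδ : 1 ≤ δ) (hM : 0 < M)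
    {s : Street} (hs : M ≤ streetCount ω s) :
    (streetCount ω s + 1) * power δ Pmax ω s ≤ 2 * Pmax * M ^ (1 - δ) := by
  have h0 : (0 : ℝ) < streetCount ω s := hM.trans_le hs
  have h1 : 1 ≤ streetCount ω s := by exact_mod_cast h0
  have h1' : (1 : ℝ) ≤ streetCount ω s := by exact_mod_cast h1
  rw [power, max_eq_left h1, div_eq_mul_inv, ← Real.rpow_neg h0.le]
  calc _ ≤ (2 * streetCount ω s) * (Pmax * (streetCount ω s : ℝ) ^ (-δ)) := by
        gcongr; linarith
    _ = 2 * Pmax * (streetCount ω s : ℝ) ^ (1 - δ) := by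
        rw [sub_eq_add_neg, Real.rpow_add h0, Real.rpow_one]; ring
    _ ≤ _ := by
        gcongr 2 * Pmax * ?_
        exact Real.rpow_le_rpow_of_nonpos hM hs (by linarith)

/-- There is a route with at most `ℓ` hops, of energy at most `E`, and whose transmissions have
power at most `P`. -/
def Linked (δ Pmax : ℝ) (ω : Config n) (E P : ℝ) (ℓ : ℕ) (a b : Site n) : Prop :=
  ∃ T : Route ω a b, T.energy δ Pmax ≤ E ∧ T.maxPower δ Pmax ≤ P ∧ T.length ≤ ℓ + 1

namespace Linked

variable {δ Pmax E E' P : ℝ} {ℓ ℓ' : ℕ} {a b c : Site n}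

lemma refl (hP : 0 ≤ P) (a : Site n) : Linked δ Pmax ω 0 P 0 a a :=
  ⟨.nil a, le_rfl, hP, le_rfl⟩

lemma trans (h : Linked δ Pmax ω E P ℓ a b) (h' : Linked δ Pmax ω E' P ℓ' b c) :
    Linked δ Pmax ω (E + E') P (ℓ + ℓ') a c := by
  obtain ⟨T, hE, hP, hl⟩ := h
  obtain ⟨T', hE', hP', hl'⟩ := h'
  have := T.length_append T'
  exact ⟨T.append T', by rw [Route.energy_append]; exact add_le_add hE hE',
    Route.maxPower_append_le hP hP', by omega⟩

lemma mono (h : Linked δ Pmax ω E P ℓ a b) (hE : E ≤ E') (hl : ℓ ≤ ℓ') :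
    Linked δ Pmax ω E' P ℓ' a b := by
  obtain ⟨T, hE', hP, hl'⟩ := h
  exact ⟨T, hE'.trans hE, hP, by omega⟩

end Linked

lemma exists_walk_of_le {δ Pmax M : ℝ} (hP : 0 ≤ Pmax) (hδ : 1 ≤ δ) (hM : 0 < M) {s : Street}
    (hs : M ≤ streetCount ω s) {a b : Site n} {t t' : ℝ} (ha : a.Present ω) (hb : b.Present ω)
    (hat : a.pos ω = s.point t) (hbt : b.pos ω = s.point t')
    (ht : t ∈ Set.Icc (0 : ℝ) 1) (ht' : t' ∈ Set.Icc (0 : ℝ) 1) (hne : t ≠ t') :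
    ∃ T : Route ω a b, T.length ≤ nodeCount ω (s.point '' openSegment ℝ t t') + 2 ∧
      T.energy δ Pmax ≤ 2 * Pmax * M ^ (1 - δ) ∧ T.maxPower δ Pmax ≤ Pmax * M ^ (-δ) ∧
      T.relays = a.relayCount + b.relayCount := by
  obtain ⟨T, h1, h2, h3, h4⟩ := exists_walk (δ := δ) hP s ha hb hat hbt ht ht' hne
  refine ⟨T, h1, ?_, h3.trans (power_le hP (by linarith) hM hs), h4⟩
  refine le_trans ?_ (streetCount_mul_power_le hP hδ hM hs)
  have h5 : nodeCount ω (s.point '' openSegment ℝ t t') ≤ streetCount ω s :=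
    nodeCount_mono (Set.image_mono (openSegment_subset_Icc ht ht'))
  have h6 : (T.length : ℝ) ≤ streetCount ω s + 2 := by exact_mod_cast h1.trans (by omega)
  have := power_nonneg hP δ ω s
  nlinarith

/-! ### Crossings -/

/-- The numerators are odd, so equal fractions have equal powers of 2 in the denominator. -/
lemma Line.offset_injective : Function.Injective Line.offset := by
  have key : ∀ l l' k k' : ℕ, (2 * k + 1) * 2 ^ l' = (2 * k' + 1) * 2 ^ l → l' ≤ l := by
    intro l l' k k' h
    by_contra! hlt
    obtain ⟨d, rfl⟩ := Nat.exists_eq_add_of_lt hlt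
    have h2 : (2 * k + 1) * 2 ^ (d + 1) = 2 * k' + 1 := by
      apply Nat.eq_of_mul_eq_mul_right (Nat.pos_of_ne_zero (pow_ne_zero l two_ne_zero))
      rw [← h, add_assoc l, pow_add 2 l]; ring
    rw [pow_succ, ← mul_assoc, mul_comm _ 2] at h2
    generalize (2 * k + 1) * 2 ^ d = m at h2
    omega
  rintro ⟨l, k⟩ ⟨l', k'⟩ h
  have h2 : (2 * (k : ℕ) + 1) * 2 ^ (l' + 1) = (2 * (k' : ℕ) + 1) * 2 ^ (l + 1) := by
    simp only [Line.offset] at h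
    rw [div_eq_div_iff (by positivity) (by positivity)] at h
    exact_mod_cast h
  obtain rfl : l = l' := by
    have h3 := key _ _ _ _ h2
    have h4 := key _ _ _ _ h2.symm
    omega
  have h5 := Nat.eq_of_mul_eq_mul_right (by positivity) h2
  have : k = k' := Fin.ext (by omega)
  rw [this]

lemma Line.offset_mem_Icc (a : Line) : a.offset ∈ Set.Icc (0 : ℝ) 1 := by
  refine ⟨by unfold Line.offset; positivity, ?_⟩
  rw [Line.offset, div_le_one (by positivity), pow_succ]
  have : ((a.2 : ℕ) : ℝ) + 1 ≤ 2 ^ a.1 := by exact_mod_cast a.2.2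
  linarith

/-- The crossing of a street with the perpendicular street along a given line. -/
def Street.cross : Street → Line → Crossing
  | Sum.inl b, a => (b, a)
  | Sum.inr b, a => (a, b)

lemma Street.point_offset (s : Street) (a : Line) : s.point a.offset = (s.cross a).point := by
  cases s <;> rfl

/-- The `k`-th dyadic piece of length `2 ^ (-L)` of a street. -/
def Street.piece (s : Street) (L : ℕ) (k : Fin (2 ^ L)) : Set (ℝ × ℝ) :=
  s.point '' Set.Icc ((k : ℕ) / 2 ^ L : ℝ) (((k : ℕ) + 1) / 2 ^ L)

lemma exists_mem_dyadic (L : ℕ) {t : ℝ} (ht : t ∈ Set.Icc (0 : ℝ) 1) :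
    ∃ k : Fin (2 ^ L), t ∈ Set.Icc ((k : ℕ) / 2 ^ L : ℝ) (((k : ℕ) + 1) / 2 ^ L) := by
  have hpos : (0 : ℝ) < 2 ^ L := by positivity
  -- At the endpoint 1 the floor would give the index 2^L, which is out of range; the last piece
  -- contains this point.
  rcases ht.2.eq_or_lt with rfl | hlt
  · have h1 : 1 ≤ 2 ^ L := Nat.one_le_two_pow
    refine ⟨⟨2 ^ L - 1, by omega⟩, ?_⟩
    simp only [Set.mem_Icc, div_le_iff₀ hpos, le_div_iff₀ hpos]
    rw [Nat.cast_sub h1]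
    push_cast
    constructor <;> linarith
  · refine ⟨⟨⌊t * 2 ^ L⌋₊, ?_⟩, ?_⟩
    · rw [Nat.floor_lt (by have := ht.1; positivity)]
      push_cast
      nlinarith
    · simp only [Set.mem_Icc, div_le_iff₀ hpos, le_div_iff₀ hpos]
      exact ⟨Nat.floor_le (by have := ht.1; positivity), (Nat.lt_floor_add_one _).le⟩

lemma offset_mem_dyadic (L : ℕ) (k : Fin (2 ^ L)) :
    Line.offset ⟨L, k⟩ ∈ Set.Icc ((k : ℕ) / 2 ^ L : ℝ) (((k : ℕ) + 1) / 2 ^ L) := by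
  have hpos : (0 : ℝ) < 2 ^ L := by positivity
  have h : Line.offset ⟨L, k⟩ = ((k : ℕ) + 1 / 2) / 2 ^ L := by
    simp only [Line.offset, pow_succ]; field_simp
  rw [h, Set.mem_Icc, div_le_div_iff_of_pos_right hpos, div_le_div_iff_of_pos_right hpos]
  constructor <;> linarith

/-- The points of the streets of level at most `L` which are not crossings. -/
def goodSet (L : ℕ) : Set (ℝ × ℝ) :=
  ⋃ (s : Street) (_ : s.level ≤ L), s.point '' (Set.Icc 0 1 \ Set.range Line.offset)

/-- A configuration in which the streets of level at most `L` carry at least `M` mobile nodes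
and their crossings carry relays, while there are at most `Q` mobile nodes on each of their dyadic
pieces of length `2 ^ (-L)` and on each street of level `L`. -/
structure WellSpread (ω : Config n) (L : ℕ) (M : ℝ) (Q : ℕ) : Prop where
  le_streetCount : ∀ s : Street, s.level ≤ L → M ≤ streetCount ω s
  relay_present : ∀ c : Crossing, c.1.1 ≤ L → c.2.1 ≤ L → 0 < ω.2 c
  piece_le : ∀ s : Street, s.level ≤ L → ∀ k : Fin (2 ^ L), nodeCount ω (s.piece L k) ≤ Q
  streetCount_le : ∀ s : Street, s.level = L → streetCount ω s ≤ Q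

/-! ### Routes through the grid of streets of level `L`. -/

namespace WellSpread

variable {L Q : ℕ} {M δ Pmax : ℝ}

lemma linked_relays_aux (h : WellSpread ω L M Q) (hP : 0 ≤ Pmax) (hδ : 1 ≤ δ) (hM : 0 < M)
    (s : Street) (hs : s.level = L) (a a' : Line) (ha : 0 < ω.2 (s.cross a))
    (ha' : 0 < ω.2 (s.cross a')) :
    Linked δ Pmax ω (2 * Pmax * M ^ (1 - δ)) (Pmax * M ^ (-δ)) (Q + 1)
      (Site.relay (s.cross a)) (Site.relay (s.cross a')) := by
  by_cases haa : a = a'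
  · subst haa
    exact (Linked.refl (by positivity) _).mono (by positivity) (by omega)
  · obtain ⟨T, h1, h2, h3, -⟩ := exists_walk_of_le hP hδ hM (h.le_streetCount s hs.le)
      (a := Site.relay (s.cross a)) (b := Site.relay (s.cross a')) ha ha'
      (s.point_offset a).symm (s.point_offset a').symm a.offset_mem_Icc a'.offset_mem_Icc
      (fun hoff => haa (Line.offset_injective hoff))
    have h4 : nodeCount ω (s.point '' openSegment ℝ a.offset a'.offset) ≤ streetCount ω s :=
      nodeCount_mono (Set.image_mono (openSegment_subset_Icc a.offset_mem_Icc a'.offset_mem_Icc))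
    have h5 := h.streetCount_le s hs
    exact ⟨T, h2, h3, by omega⟩

/-- Both relays lie on grid streets perpendicular to `s` and `s'`. If `s` and `s'` are
perpendicular, these two grid streets cross each other. If they are parallel, a third grid street is
needed, and the one with the coordinate of `a` in the other direction serves. -/
lemma linked_relays (h : WellSpread ω L M Q) (hP : 0 ≤ Pmax) (hδ : 1 ≤ δ) (hM : 0 < M)
    {s s' : Street} (hs : s.level ≤ L) (hs' : s'.level ≤ L) {a a' : Line} (ha : a.1 = L)
    (ha' : a'.1 = L) :
    Linked δ Pmax ω (6 * Pmax * M ^ (1 - δ)) (Pmax * M ^ (-δ)) (3 * (Q + 1))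
      (Site.relay (s.cross a)) (Site.relay (s'.cross a')) := by
  have hE : 0 ≤ Pmax * M ^ (1 - δ) := by positivity
  have V : ∀ b a a' : Line, b.1 = L → a.1 ≤ L → a'.1 ≤ L →
      Linked δ Pmax ω (2 * Pmax * M ^ (1 - δ)) (Pmax * M ^ (-δ)) (Q + 1)
        (Site.relay (b, a)) (Site.relay (b, a')) := fun b a a' hb ha ha' =>
    h.linked_relays_aux hP hδ hM (Sum.inl b) hb a a' (h.relay_present _ hb.le ha)
      (h.relay_present _ hb.le ha')
  have H : ∀ b a a' : Line, b.1 = L → a.1 ≤ L → a'.1 ≤ L →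
      Linked δ Pmax ω (2 * Pmax * M ^ (1 - δ)) (Pmax * M ^ (-δ)) (Q + 1)
        (Site.relay (a, b)) (Site.relay (a', b)) := fun b a a' hb ha ha' =>
    h.linked_relays_aux hP hδ hM (Sum.inr b) hb a a' (h.relay_present _ ha hb.le)
      (h.relay_present _ ha' hb.le)
  rcases s with b | b <;> rcases s' with b' | b'
  · exact ((H a b a ha hs ha.le).trans ((V a a a' ha ha.le ha'.le).trans
      (H a' a b' ha' ha.le hs'))).mono (by linarith) (by omega)
  · exact ((H a b a' ha hs ha'.le).trans (V a' a b' ha' ha.le hs')).mono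
      (by linarith) (by omega)
  · exact ((V a b a' ha hs ha'.le).trans (H a' a b' ha' ha.le hs')).mono
      (by linarith) (by omega)
  · exact ((V a b a ha hs ha.le).trans ((H a a a' ha ha.le ha'.le).trans
      (V a' a b' ha' ha.le hs'))).mono (by linarith) (by omega)

/-- The perpendicular street through the midpoint of a dyadic piece has level exactly `L`, so the
walk to it stays inside the piece containing the node. Excluding crossings from `goodSet` keeps node
and relay at different points. -/
lemma exists_linked_mobile (h : WellSpread ω L M Q) (hP : 0 ≤ Pmax) (hδ : 1 ≤ δ) (hM : 0 < M)
    {i : Fin n} (hi : ω.1 i ∈ goodSet L) :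
    ∃ (s : Street) (a : Line), s.level ≤ L ∧ a.1 = L ∧
      Linked δ Pmax ω (2 * Pmax * M ^ (1 - δ)) (Pmax * M ^ (-δ)) (Q + 1)
        (Site.mobile i) (Site.relay (s.cross a)) ∧
      Linked δ Pmax ω (2 * Pmax * M ^ (1 - δ)) (Pmax * M ^ (-δ)) (Q + 1)
        (Site.relay (s.cross a)) (Site.mobile i) := by
  simp only [goodSet, Set.mem_iUnion] at hi
  obtain ⟨s, hs, t, ⟨ht, hto⟩, hti⟩ := hi
  obtain ⟨k, hk⟩ := exists_mem_dyadic L ht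
  set a : Line := ⟨L, k⟩ with ha
  have hne : t ≠ a.offset := fun hta => hto ⟨a, hta.symm⟩
  have hseg : nodeCount ω (s.point '' openSegment ℝ t a.offset) ≤ Q :=
    (nodeCount_mono (Set.image_mono
      ((convex_Icc _ _).openSegment_subset hk (offset_mem_dyadic L k)))).trans (h.piece_le s hs k)
  have hrel : (Site.relay (s.cross a) : Site n).Present ω := by
    cases s
    · exact h.relay_present _ hs le_rfl
    · exact h.relay_present _ le_rfl hs
  refine ⟨s, a, hs, rfl, ?_, ?_⟩
  · obtain ⟨T, h1, h2, h3, -⟩ := exists_walk_of_le hP hδ hM (h.le_streetCount s hs)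
      (a := Site.mobile i) trivial hrel hti.symm (s.point_offset a).symm ht a.offset_mem_Icc hne
    exact ⟨T, h2, h3, by omega⟩
  · obtain ⟨T, h1, h2, h3, -⟩ := exists_walk_of_le hP hδ hM (h.le_streetCount s hs)
      (b := Site.mobile i) hrel trivial (s.point_offset a).symm hti.symm a.offset_mem_Icc ht
      hne.symm
    rw [openSegment_symm] at h1
    exact ⟨T, h2, h3, by omega⟩

/-- Two nodes outside the crossings of streets of level at most `L` are linked by a route which
follows their own streets and at most three streets of level `L`. -/
lemma linked_mobile (h : WellSpread ω L M Q) (hP : 0 ≤ Pmax) (hδ : 1 ≤ δ) (hM : 0 < M)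
    {i j : Fin n} (hi : ω.1 i ∈ goodSet L) (hj : ω.1 j ∈ goodSet L) :
    Linked δ Pmax ω (10 * Pmax * M ^ (1 - δ)) (Pmax * M ^ (-δ)) (5 * (Q + 1))
      (Site.mobile i) (Site.mobile j) := by
  obtain ⟨s, a, hs, ha, hl, -⟩ := h.exists_linked_mobile (δ := δ) hP hδ hM hi
  obtain ⟨s', a', hs', ha', -, hl'⟩ := h.exists_linked_mobile (δ := δ) hP hδ hM hj
  exact ((hl.trans (h.linked_relays hP hδ hM hs hs' ha ha')).trans hl').mono
    (by linarith) (by omega)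

variable {κ : Criterion} {B : ℝ}

/-- The budget suffices for the routes through five streets with at least `M` nodes. -/
def Affordable (δ Pmax M : ℝ) (B : ℝ) : Criterion → Prop
  | Criterion.accumulated => 10 * Pmax * M ^ (1 - δ) ≤ B
  | Criterion.maximum => Pmax * M ^ (-δ) ≤ B

lemma exists_route (h : WellSpread ω L M Q) (hP : 0 ≤ Pmax) (hδ : 1 ≤ δ) (hM : 0 < M)
    (hB : Affordable δ Pmax M B κ) {i j : Fin n} (hi : ω.1 i ∈ goodSet L)
    (hj : ω.1 j ∈ goodSet L) :
    ∃ T : Route ω (Site.mobile i) (Site.mobile j),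
      T.cost δ Pmax κ ≤ B ∧ T.length ≤ 5 * (Q + 1) + 1 := by
  obtain ⟨T, h1, h2, h3⟩ := h.linked_mobile (δ := δ) hP hδ hM hi hj
  cases κ
  · exact ⟨T, h1.trans hB, h3⟩
  · exact ⟨T, h2.trans hB, h3⟩

lemma hopCount_le (h : WellSpread ω L M Q) (hP : 0 ≤ Pmax) (hδ : 1 ≤ δ) (hM : 0 < M)
    (hB : Affordable δ Pmax M B κ) {i j : Fin n} (hi : ω.1 i ∈ goodSet L)
    (hj : ω.1 j ∈ goodSet L) : hopCount δ Pmax κ B ω i j ≤ 5 * (Q + 1) + 1 := by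
  obtain ⟨T, h1, h2⟩ := h.exists_route hP hδ hM hB hi hj
  have h3 : hopCount δ Pmax κ B ω i j ≤ T.length := Nat.sInf_le ⟨T, h1, rfl⟩
  exact h3.trans h2

/-- Every street crosses the perpendicular street of level 0. The walk along the node's own street
to that crossing uses a single relay, its endpoint. -/
lemma mem_component (h : WellSpread ω L M Q) (hP : 0 ≤ Pmax) (hδ : 1 ≤ δ) (hM : 0 < M)
    (hB : Affordable δ Pmax M B κ) {i : Fin n} (hi : ω.1 i ∈ goodSet L) :
    i ∈ component δ Pmax κ 1 B ω := by
  simp only [goodSet, Set.mem_iUnion] at hi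
  obtain ⟨s, hs, t, ⟨ht, hto⟩, hti⟩ := hi
  set a : Line := ⟨0, 0⟩ with ha
  have hne : t ≠ a.offset := fun hta => hto ⟨a, hta.symm⟩
  have hrel : (Site.relay (s.cross a) : Site n).Present ω := by
    cases s
    · exact h.relay_present _ hs (Nat.zero_le _)
    · exact h.relay_present _ (Nat.zero_le _) hs
  obtain ⟨T, h1, h2, h3, h4⟩ := exists_walk_of_le (δ := δ) hP hδ hM (h.le_streetCount s hs)
    (a := Site.mobile i) trivial hrel hti.symm (s.point_offset a).symm ht a.offset_mem_Icc hne
  refine ⟨_, T, ?_, by simp [h4, Site.relayCount], ?_⟩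
  · have hmem : ∀ u : Street, u.level = 0 → u.carrier ⊆ support 0 := fun u hu =>
      Set.subset_iUnion₂_of_subset u hu le_rfl
    cases s with
    | inl b => exact hmem (Sum.inr a) rfl ⟨b.offset, b.offset_mem_Icc, rfl⟩
    | inr b => exact hmem (Sum.inl a) rfl ⟨b.offset, b.offset_mem_Icc, rfl⟩
  · have : 0 ≤ Pmax * M ^ (1 - δ) := by positivity
    cases κ
    · exact h2.trans (le_trans (by linarith) hB)
    · exact h3.trans hB

lemma mem_joinedPairs (h : WellSpread ω L M Q) (hP : 0 ≤ Pmax) (hδ : 1 ≤ δ) (hM : 0 < M)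
    (hB : Affordable δ Pmax M B κ) {i j : Fin n} (hi : ω.1 i ∈ goodSet L)
    (hj : ω.1 j ∈ goodSet L) : (i, j) ∈ joinedPairs δ Pmax κ B ω := by
  obtain ⟨T, h1, -⟩ := h.exists_route hP hδ hM hB hi hj
  exact ⟨h.mem_component hP hδ hM hB hi, h.mem_component hP hδ hM hB hj, T, h1⟩

end WellSpread

/-! ### Deterministic bounds for the throughput -/

section Throughput

variable {δ Pmax B C : ℝ} {κ : Criterion}

lemma mem_component_of_mem_support (hB : 0 ≤ B) {i : Fin n} (hi : ω.1 i ∈ support 0) (k : ℕ) :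
    i ∈ component δ Pmax κ k B ω := by
  refine ⟨Site.mobile i, .nil _, hi, by simp [Route.relays, Site.relayCount], ?_⟩
  cases κ <;> simpa [Route.cost, Route.energy, Route.maxPower]

lemma streetCount_le_ncard_component (hB : 0 ≤ B) {s : Street} (hs : s.level = 0) (k : ℕ) :
    streetCount ω s ≤ (component δ Pmax κ k B ω).ncard := by
  refine Set.ncard_le_ncard (fun i hi => ?_) (Set.toFinite _)
  exact mem_component_of_mem_support hB (Set.mem_iUnion₂.2 ⟨s, hs, hi⟩) k

lemma one_le_hopCount {x : Fin n × Fin n} (hx : x ∈ joinedPairs δ Pmax κ B ω) :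
    1 ≤ hopCount δ Pmax κ B ω x.1 x.2 := by
  obtain ⟨-, -, T, hT⟩ := hx
  obtain ⟨T', -, h⟩ := Nat.sInf_mem (s := {d | ∃ T : Route ω (Site.mobile x.1) (Site.mobile x.2),
    T.cost δ Pmax κ ≤ B ∧ T.length = d}) ⟨_, T, hT, rfl⟩
  exact T'.one_le_length.trans h.le

open Classical in
/-- A lower bound for the throughput from a bound of the number of nodes of the component and of
the total length of the routes. -/
lemma le_throughput (hB : 0 ≤ B) (hC : 0 ≤ C) {g S : ℝ} (hg : 0 < g)
    (hcomp : g ≤ (component δ Pmax κ 1 B ω).ncard)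
    (hS : ∑ x with x ∈ joinedPairs δ Pmax κ B ω, (hopCount δ Pmax κ B ω x.1 x.2 : ℝ) ≤ S) :
    (n : ℝ) ^ 2 * (C * g) / S ≤ throughput δ Pmax κ B (fun _ => C) ω := by
  have hne : (component δ Pmax κ 1 B ω).Nonempty := by
    rw [← Set.ncard_pos]
    exact_mod_cast hg.trans_le hcomp
  obtain ⟨i, hi⟩ := hne
  have hii : (i, i) ∈ joinedPairs δ Pmax κ B ω := by
    refine ⟨hi, hi, .nil _, ?_⟩
    cases κ <;> simpa [Route.cost, Route.energy, Route.maxPower]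
  -- The trivial route from `i` to itself has length 1. This excludes a zero denominator, for which
  -- the quotient would be 0 by convention.
  have hpos : 0 < ∑ x with x ∈ joinedPairs δ Pmax κ B ω,
      (hopCount δ Pmax κ B ω x.1 x.2 : ℝ) := by
    refine Finset.sum_pos' (fun x _ => Nat.cast_nonneg _) ⟨(i, i), by simpa using hii, ?_⟩
    exact_mod_cast one_le_hopCount hii
  have hsum : C * g ≤ ∑ i with i ∈ component δ Pmax κ 1 B ω, C := by
    rw [Finset.sum_const, nsmul_eq_mul, mul_comm]
    refine mul_le_mul_of_nonneg_right (hcomp.trans_eq ?_) hC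
    rw [Set.ncard_eq_toFinset_card']
    congr 2
    ext; simp
  unfold throughput
  gcongr

-- The crude bound, which needs no control of the streets; it settles the case α ≤ 0.
open Classical in
lemma sum_hopCount_le_cube (hP : 0 ≤ Pmax) {m : ℕ} (hm : {c | 0 < ω.2 c}.encard ≤ m) :
    ∑ x with x ∈ joinedPairs δ Pmax κ B ω, (hopCount δ Pmax κ B ω x.1 x.2 : ℝ) ≤
      (n : ℝ) ^ 2 * (n + m) := by
  calc _ ≤ ∑ x with x ∈ joinedPairs δ Pmax κ B ω, ((n : ℝ) + m) := by
        refine Finset.sum_le_sum fun x hx => ?_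
        exact_mod_cast hopCount_le_of_encard_relays hP hm (Finset.mem_filter.1 hx).2.2.2
    _ ≤ ∑ x : Fin n × Fin n, ((n : ℝ) + m) :=
        Finset.sum_le_sum_of_subset_of_nonneg (Finset.filter_subset _ _)
          fun _ _ _ => by positivity
    _ = _ := by simp; ring

open Classical in
lemma card_pairs_not_mem_le (A : Set (ℝ × ℝ)) :
    (Finset.univ.filter fun x : Fin n × Fin n => ¬(ω.1 x.1 ∈ A ∧ ω.1 x.2 ∈ A)).card ≤
      2 * n * nodeCount ω Aᶜ := by
  set T : Finset (Fin n) := Finset.univ.filter fun i => ω.1 i ∈ Aᶜ with hT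
  have hcard : nodeCount ω Aᶜ = T.card := by
    rw [nodeCount, Set.ncard_eq_toFinset_card']
    congr 1
    ext; simp [hT]
  have hsub : (Finset.univ.filter fun x : Fin n × Fin n => ¬(ω.1 x.1 ∈ A ∧ ω.1 x.2 ∈ A)) ⊆
      T ×ˢ Finset.univ ∪ Finset.univ ×ˢ T := by
    intro x
    simp only [Finset.mem_filter, Finset.mem_union, Finset.mem_product, hT, Set.mem_compl_iff,
      Finset.mem_univ, true_and, and_true]
    tauto
  refine (Finset.card_le_card hsub).trans ((Finset.card_union_le _ _).trans ?_)
  rw [Finset.card_product, Finset.card_product, Finset.card_univ, Fintype.card_fin, hcard]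
  apply le_of_eq; ring

variable {L Q : ℕ} {M : ℝ}

-- Pairs inside `goodSet` use the short grid routes. Every other pair is charged the number of all
-- available sites, and such pairs are few.
open Classical in
lemma WellSpread.sum_hopCount_le (h : WellSpread ω L M Q) (hP : 0 ≤ Pmax) (hδ : 1 ≤ δ)
    (hM : 0 < M) (hB : WellSpread.Affordable δ Pmax M B κ) {m : ℕ}
    (hm : {c | 0 < ω.2 c}.encard ≤ m) :
    ∑ x with x ∈ joinedPairs δ Pmax κ B ω, (hopCount δ Pmax κ B ω x.1 x.2 : ℝ) ≤
      (n : ℝ) ^ 2 * (5 * (Q + 1) + 1) + 2 * n * nodeCount ω (goodSet L)ᶜ * (n + m) := by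
  calc _ ≤ ∑ x with x ∈ joinedPairs δ Pmax κ B ω, ((5 * (Q + 1) + 1 : ℝ) +
          if ¬(ω.1 x.1 ∈ goodSet L ∧ ω.1 x.2 ∈ goodSet L) then (n + m : ℝ) else 0) := by
        refine Finset.sum_le_sum fun x hx => ?_
        split_ifs with hx'
        · rw [add_zero]
          exact_mod_cast h.hopCount_le hP hδ hM hB hx'.1 hx'.2
        · have := hopCount_le_of_encard_relays hP hm (Finset.mem_filter.1 hx).2.2.2
          have h1 : (hopCount δ Pmax κ B ω x.1 x.2 : ℝ) ≤ n + m := by exact_mod_cast this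
          exact h1.trans (le_add_of_nonneg_left (by positivity))
    _ ≤ ∑ x : Fin n × Fin n, ((5 * (Q + 1) + 1 : ℝ) +
          if ¬(ω.1 x.1 ∈ goodSet L ∧ ω.1 x.2 ∈ goodSet L) then (n + m : ℝ) else 0) := by
        refine Finset.sum_le_sum_of_subset_of_nonneg (Finset.filter_subset _ _) fun _ _ _ => ?_
        split_ifs <;> positivity
    _ ≤ _ := by
        rw [Finset.sum_add_distrib, ← Finset.sum_filter, Finset.sum_const, Finset.sum_const,
          nsmul_eq_mul, nsmul_eq_mul]
        gcongr ?_ * _ + ?_ * _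
        · simp [sq]
        · exact_mod_cast card_pairs_not_mem_le (ω := ω) (goodSet L)

lemma WellSpread.le_ncard_joinedPairs (h : WellSpread ω L M Q) (hP : 0 ≤ Pmax) (hδ : 1 ≤ δ)
    (hM : 0 < M) (hB : WellSpread.Affordable δ Pmax M B κ) :
    (n : ℝ) ^ 2 - 2 * n * nodeCount ω (goodSet L)ᶜ ≤ (joinedPairs δ Pmax κ B ω).ncard := by
  classical
  have h1 : (Finset.univ.filter fun x : Fin n × Fin n =>
      ω.1 x.1 ∈ goodSet L ∧ ω.1 x.2 ∈ goodSet L).card ≤ (joinedPairs δ Pmax κ B ω).ncard := by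
    rw [← Set.ncard_coe_finset]
    refine Set.ncard_le_ncard (fun x hx => ?_) (Set.toFinite _)
    have hx' := (Finset.mem_filter.1 hx).2
    exact h.mem_joinedPairs hP hδ hM hB hx'.1 hx'.2
  have h2 := Finset.card_filter_add_card_filter_not (s := Finset.univ) (fun x : Fin n × Fin n =>
      ω.1 x.1 ∈ goodSet L ∧ ω.1 x.2 ∈ goodSet L)
  rw [Finset.card_univ, Fintype.card_prod, Fintype.card_fin] at h2
  have h3 := card_pairs_not_mem_le (ω := ω) (goodSet L)
  have h4 : n * n ≤ (joinedPairs δ Pmax κ B ω).ncard + 2 * n * nodeCount ω (goodSet L)ᶜ := by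
    omega
  have h5 : (n * n : ℝ) ≤ (joinedPairs δ Pmax κ B ω).ncard + 2 * n * nodeCount ω (goodSet L)ᶜ := by
    exact_mod_cast h4
  linarith [sq (n : ℝ)]

end Throughput

end Routes

/-! ### Chernoff bounds -/

section Chernoff

variable {Ω ι : Type*} [MeasurableSpace Ω] {μ : Measure Ω} [IsProbabilityMeasure μ]

/-- The moment generating function is 1 + (e^t - 1) P(A), and 1 + y ≤ e^y. -/
lemma mgf_indicator_le {A : Set Ω} (hA : MeasurableSet A) (t : ℝ) :
    mgf (A.indicator 1) μ t ≤ Real.exp ((Real.exp t - 1) * μ.real A) := by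
  have h : (fun ω => Real.exp (t * A.indicator (1 : Ω → ℝ) ω)) =
      fun ω => 1 + A.indicator (fun _ => Real.exp t - 1) ω := by
    ext ω
    by_cases hω : ω ∈ A <;> simp [hω]
  rw [mgf, h, integral_add (integrable_const _) ((integrable_const _).indicator hA),
    integral_indicator_const _ hA]
  simp only [integral_const, probReal_univ, smul_eq_mul, mul_one]
  linarith [Real.add_one_le_exp ((Real.exp t - 1) * μ.real A)]

lemma mgf_sum_indicator_le {A : ι → Set Ω} (hA : ∀ i, MeasurableSet (A i))
    (hind : iIndepFun (fun i => (A i).indicator (1 : Ω → ℝ)) μ) (S : Finset ι) (t : ℝ) :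
    mgf (∑ i ∈ S, (A i).indicator (1 : Ω → ℝ)) μ t ≤
      Real.exp ((Real.exp t - 1) * ∑ i ∈ S, μ.real (A i)) := by
  rw [hind.mgf_sum (fun i => measurable_one.indicator (hA i)), Finset.mul_sum, Real.exp_sum]
  exact Finset.prod_le_prod (fun i _ => mgf_nonneg) fun i _ => mgf_indicator_le (hA i) t

lemma integrable_exp_sum_indicator {A : ι → Set Ω} (hA : ∀ i, MeasurableSet (A i))
    (S : Finset ι) (t : ℝ) :
    Integrable (fun ω => Real.exp (t * (∑ i ∈ S, (A i).indicator (1 : Ω → ℝ)) ω)) μ := by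
  have hm : Measurable (∑ i ∈ S, (A i).indicator (1 : Ω → ℝ)) := by
    rw [Finset.sum_fn]
    exact Finset.measurable_sum S fun i _ => measurable_one.indicator (hA i)
  refine integrable_exp_mul_of_mem_Icc (a := 0) (b := S.card) hm.aemeasurable
    (ae_of_all _ fun ω => ?_)
  rw [Finset.sum_apply]
  refine ⟨Finset.sum_nonneg fun i _ => Set.indicator_nonneg (fun _ _ => zero_le_one) _, ?_⟩
  refine (Finset.sum_le_card_nsmul S _ 1 fun i _ => ?_).trans (by simp)
  exact Set.indicator_le' (fun _ _ => le_rfl) (fun _ _ => zero_le_one) ω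

/-- Chernoff's bound at t = 1, with e - 1 ≤ 2. -/
lemma measure_le_sum_indicator_le {A : ι → Set Ω} (hA : ∀ i, MeasurableSet (A i))
    (hind : iIndepFun (fun i => (A i).indicator (1 : Ω → ℝ)) μ) (S : Finset ι) (k : ℝ) :
    μ {ω | k ≤ (∑ i ∈ S, (A i).indicator (1 : Ω → ℝ)) ω} ≤
      ENNReal.ofReal (Real.exp (2 * ∑ i ∈ S, μ.real (A i) - k)) := by
  rw [← ofReal_measureReal]
  refine ENNReal.ofReal_le_ofReal ((measure_ge_le_exp_mul_mgf k zero_le_one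
    (integrable_exp_sum_indicator hA S 1)).trans ?_)
  refine (mul_le_mul_of_nonneg_left (mgf_sum_indicator_le hA hind S 1) (Real.exp_pos _).le).trans ?_
  rw [← Real.exp_add, Real.exp_le_exp]
  have h1 : 0 ≤ ∑ i ∈ S, μ.real (A i) := Finset.sum_nonneg fun _ _ => measureReal_nonneg
  nlinarith [Real.exp_one_lt_d9]

/-- Chernoff's bound at t = -1, with e⁻¹ - 1 ≤ -1/2. -/
lemma measure_sum_indicator_le_le {A : ι → Set Ω} (hA : ∀ i, MeasurableSet (A i))
    (hind : iIndepFun (fun i => (A i).indicator (1 : Ω → ℝ)) μ) (S : Finset ι) (k : ℝ) :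
    μ {ω | (∑ i ∈ S, (A i).indicator (1 : Ω → ℝ)) ω ≤ k} ≤
      ENNReal.ofReal (Real.exp (k - (∑ i ∈ S, μ.real (A i)) / 2)) := by
  rw [← ofReal_measureReal]
  refine ENNReal.ofReal_le_ofReal ((measure_le_le_exp_mul_mgf k (t := -1) (by norm_num)
    (integrable_exp_sum_indicator hA S (-1))).trans ?_)
  refine (mul_le_mul_of_nonneg_left (mgf_sum_indicator_le hA hind S (-1))
    (Real.exp_pos _).le).trans ?_
  rw [← Real.exp_add, Real.exp_le_exp]
  have h1 : 0 ≤ ∑ i ∈ S, μ.real (A i) := Finset.sum_nonneg fun _ _ => measureReal_nonneg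
  have h2 : Real.exp (-1) ≤ 1 / 2 := by
    rw [Real.exp_neg, inv_eq_one_div]
    exact one_div_le_one_div_of_le two_pos (by linarith [Real.exp_one_gt_d9])
  nlinarith

end Chernoff

/-! ### The law of a mobile node -/

lemma hasSum_line {f : ℕ → ℝ} (hf : ∀ l, 0 ≤ f l) {a : ℝ} (h : HasSum (fun l => 2 ^ l * f l) a) :
    HasSum (fun b : Line => f b.1) a := by
  have h1 : ∀ l : ℕ, HasSum (fun _ : Fin (2 ^ l) => f l) (2 ^ l * f l) := fun l => by
    convert! hasSum_fintype (fun _ : Fin (2 ^ l) => f l) using 1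
    simp
  refine HasSum.sigma_of_hasSum h h1 ?_
  refine (summable_sigma_of_nonneg fun b => hf b.1).2 ⟨fun l => (h1 l).summable, ?_⟩
  simpa only [(h1 _).tsum_eq] using h.summable

/-- There are 2^l lines of level l, so the levels from k on form the geometric series of p (1 -
p)^l. -/
lemma hasSum_line_tail {p : ℝ} (hp₀ : 0 < p) (hp₁ : p < 1) (k : ℕ) :
    HasSum (fun b : Line => if b.1 < k then 0 else p * ((1 - p) / 2) ^ b.1) ((1 - p) ^ k) := by
  have hq : 0 < 1 - p := by linarith
  refine hasSum_line (f := fun l => if l < k then 0 else p * ((1 - p) / 2) ^ l)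
    (fun l => by positivity) ?_
  have h1 : HasSum (fun l : ℕ => p * (1 - p) ^ k * (1 - p) ^ l) ((1 - p) ^ k) := by
    convert! (hasSum_geometric_of_lt_one hq.le (by linarith)).mul_left (p * (1 - p) ^ k) using 1
    rw [sub_sub_cancel]
    field_simp
  have h2 : ∑ l ∈ Finset.range k, (2 ^ l * if l < k then 0 else p * ((1 - p) / 2) ^ l) = 0 :=
    Finset.sum_eq_zero fun l hl => by simp [Finset.mem_range.1 hl]
  have h3 := (hasSum_nat_add_iff (f := fun l : ℕ =>
    2 ^ l * if l < k then 0 else p * ((1 - p) / 2) ^ l) (g := (1 - p) ^ k) k).1 ?_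
  · rwa [h2, add_zero] at h3
  · convert! h1 using 2 with l
    rw [if_neg (by omega), div_pow, pow_add (1 - p)]
    field_simp

lemma hasSum_line_one {p : ℝ} (hp₀ : 0 < p) (hp₁ : p < 1) :
    HasSum (fun b : Line => p * ((1 - p) / 2) ^ b.1) 1 := by
  simpa using hasSum_line_tail hp₀ hp₁ 0

lemma hasSum_street_tail {p : ℝ} (hp₀ : 0 < p) (hp₁ : p < 1) (k : ℕ) :
    HasSum (fun s : Street => if s.level < k then 0 else p / 2 * ((1 - p) / 2) ^ s.level)
      ((1 - p) ^ k) := by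
  have h := (hasSum_line_tail hp₀ hp₁ k).div_const 2
  have h2 : (fun b : Line => (if b.1 < k then 0 else p * ((1 - p) / 2) ^ b.1) / 2) =
      fun b : Line => if b.1 < k then 0 else p / 2 * ((1 - p) / 2) ^ b.1 := by
    ext b; split_ifs <;> ring
  rw [h2] at h
  rw [← add_halves ((1 - p) ^ k)]
  exact HasSum.sum h h

lemma hasSum_street_one {p : ℝ} (hp₀ : 0 < p) (hp₁ : p < 1) :
    HasSum (fun s : Street => p / 2 * ((1 - p) / 2) ^ s.level) 1 := by
  simpa using hasSum_street_tail hp₀ hp₁ 0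

lemma Street.isometry_point (s : Street) : Isometry s.point := by
  refine Isometry.of_dist_eq fun t t' => ?_
  cases s <;> simp [Street.point, Prod.dist_eq]

lemma Street.measurableEmbedding_point (s : Street) : MeasurableEmbedding s.point :=
  s.isometry_point.isClosedEmbedding.measurableEmbedding

lemma nodeLaw_apply (p : ℝ) (A : Set (ℝ × ℝ)) :
    nodeLaw p A = ∑' s : Street, ENNReal.ofReal (p / 2 * ((1 - p) / 2) ^ s.level) *
      volume (s.point ⁻¹' A ∩ Set.Icc 0 1) := by
  rw [nodeLaw, Measure.sum_apply_of_countable]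
  congr with s
  rw [Measure.smul_apply, s.measurableEmbedding_point.map_apply,
    Measure.restrict_apply₀' measurableSet_Icc.nullMeasurableSet, smul_eq_mul]

lemma isProbabilityMeasure_nodeLaw {p : ℝ} (hp₀ : 0 < p) (hp₁ : p < 1) :
    IsProbabilityMeasure (nodeLaw p) := by
  have hq : 0 < 1 - p := by linarith
  constructor
  rw [nodeLaw_apply]
  have h := hasSum_street_one hp₀ hp₁
  simp only [Set.preimage_univ, Set.univ_inter, Real.volume_Icc, sub_zero, ENNReal.ofReal_one,
    mul_one]
  rw [← ENNReal.ofReal_tsum_of_nonneg (fun s => by positivity) h.summable, h.tsum_eq,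
    ENNReal.ofReal_one]

lemma Street.subsingleton_preimage_image {s s' : Street} (h : s' ≠ s) (J : Set ℝ) :
    (s'.point ⁻¹' (s.point '' J)).Subsingleton := by
  rintro t ⟨u, -, hu⟩ t' ⟨u', -, hu'⟩
  rcases s with a | a <;> rcases s' with b | b <;>
    simp only [Street.point, Prod.mk.injEq] at hu hu'
  · exact absurd (congrArg _ (Line.offset_injective hu.1).symm) h
  · exact hu.1.symm.trans hu'.1
  · exact hu.2.symm.trans hu'.2
  · exact absurd (congrArg _ (Line.offset_injective hu.2).symm) h

/-- Any other street meets `s` in at most one point, which its length measure ignores. -/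
lemma nodeLaw_image (p : ℝ) (s : Street) (J : Set ℝ) :
    nodeLaw p (s.point '' J) =
      ENNReal.ofReal (p / 2 * ((1 - p) / 2) ^ s.level) * volume (J ∩ Set.Icc 0 1) := by
  rw [nodeLaw_apply, tsum_eq_single s, s.point_injective.preimage_image]
  intro s' hs'
  rw [((Street.subsingleton_preimage_image hs' J).anti Set.inter_subset_left).measure_zero,
    mul_zero]

lemma nodeLaw_carrier (p : ℝ) (s : Street) :
    nodeLaw p s.carrier = ENNReal.ofReal (p / 2 * ((1 - p) / 2) ^ s.level) := by
  rw [Street.carrier, nodeLaw_image]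
  simp

/-- Streets of level at most `L` lose only countably many points; what remains is the mass of the
higher levels. -/
lemma nodeLaw_compl_goodSet_le {p : ℝ} (hp₀ : 0 < p) (hp₁ : p < 1) (L : ℕ) :
    nodeLaw p (goodSet L)ᶜ ≤ ENNReal.ofReal ((1 - p) ^ (L + 1)) := by
  have hq : 0 < 1 - p := by linarith
  have h := hasSum_street_tail hp₀ hp₁ (L + 1)
  rw [nodeLaw_apply, ← h.tsum_eq,
    ENNReal.ofReal_tsum_of_nonneg (fun s => by positivity) h.summable]
  refine ENNReal.tsum_le_tsum fun s => ?_
  split_ifs with hs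
  · have h0 : volume (s.point ⁻¹' (goodSet L)ᶜ ∩ Set.Icc 0 1) = 0 := by
      refine measure_mono_null ?_ ((Set.countable_range Line.offset).measure_zero _)
      rintro t ⟨ht, ht'⟩
      by_contra hto
      exact ht (Set.mem_iUnion₂.2 ⟨s, by omega, t, ⟨ht', hto⟩, rfl⟩)
    rw [h0]
    simp
  · refine mul_le_of_le_one_right' ((measure_mono Set.inter_subset_right).trans ?_)
    simp

lemma measurableSet_goodSet (L : ℕ) : MeasurableSet (goodSet L) :=
  MeasurableSet.iUnion fun s => MeasurableSet.iUnion fun _ =>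
    s.measurableEmbedding_point.measurableSet_image'
      (measurableSet_Icc.diff (Set.countable_range _).measurableSet)

/-! ### Events of the network law -/

section Events

variable {p pr : ℝ} {n : ℕ}

/-- An inequality suffices for upper bounds and holds for every set, so no measurability of events
has to be checked. -/
lemma networkLaw_fst_preimage_le (A : Set (Fin n → ℝ × ℝ)) :
    networkLaw p pr n (Prod.fst ⁻¹' A) ≤ Measure.pi (fun _ : Fin n => nodeLaw p) A := by
  refine (Measure.le_map_apply measurable_fst.aemeasurable A).trans_eq ?_
  rw [networkLaw, Measure.map_fst_prod, measure_univ, one_smul]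

lemma networkLaw_snd_preimage_le (hp₀ : 0 < p) (hp₁ : p < 1) (A : Set (Crossing → ℕ)) :
    networkLaw p pr n (Prod.snd ⁻¹' A) ≤ Measure.infinitePi
      (fun c : Crossing => poissonMeasure (relayIntensity pr n c).toNNReal) A := by
  have := isProbabilityMeasure_nodeLaw hp₀ hp₁
  refine (Measure.le_map_apply measurable_snd.aemeasurable A).trans_eq ?_
  rw [networkLaw, Measure.map_snd_prod, measure_univ, one_smul]

lemma isProbabilityMeasure_networkLaw (hp₀ : 0 < p) (hp₁ : p < 1) :
    IsProbabilityMeasure (networkLaw p pr n) := by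
  have := isProbabilityMeasure_nodeLaw hp₀ hp₁
  unfold networkLaw
  infer_instance

lemma sum_indicator_eq_nodeCount (ω : Config n) (A : Set (ℝ × ℝ)) :
    (∑ i : Fin n, {x : Fin n → ℝ × ℝ | x i ∈ A}.indicator (1 : (Fin n → ℝ × ℝ) → ℝ)) ω.1 =
      nodeCount ω A := by
  classical
  rw [Finset.sum_apply, nodeCount, Set.ncard_eq_toFinset_card']
  simp [Set.indicator_apply]

lemma iIndepFun_indicator_nodes (hp₀ : 0 < p) (hp₁ : p < 1) {A : Set (ℝ × ℝ)}
    (hA : MeasurableSet A) :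
    iIndepFun (fun i => {x : Fin n → ℝ × ℝ | x i ∈ A}.indicator (1 : (Fin n → ℝ × ℝ) → ℝ))
      (Measure.pi fun _ : Fin n => nodeLaw p) := by
  have := isProbabilityMeasure_nodeLaw hp₀ hp₁
  exact iIndepFun_pi (μ := fun _ : Fin n => nodeLaw p)
    (X := fun _ : Fin n => A.indicator (1 : ℝ × ℝ → ℝ))
    fun _ => (measurable_one.indicator hA).aemeasurable

lemma sum_pi_real (hp₀ : 0 < p) (hp₁ : p < 1) {A : Set (ℝ × ℝ)} (hA : MeasurableSet A) :
    ∑ i : Fin n, (Measure.pi fun _ : Fin n => nodeLaw p).real {x : Fin n → ℝ × ℝ | x i ∈ A} =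
      n * (nodeLaw p).real A := by
  have := isProbabilityMeasure_nodeLaw hp₀ hp₁
  have h : ∀ i : Fin n, (Measure.pi fun _ : Fin n => nodeLaw p).real
      {x : Fin n → ℝ × ℝ | x i ∈ A} = (nodeLaw p).real A := fun i =>
    (measurePreserving_eval (fun _ : Fin n => nodeLaw p) i).measureReal_preimage
      hA.nullMeasurableSet
  simp [h]

lemma networkLaw_le_nodeCount (hp₀ : 0 < p) (hp₁ : p < 1) {A : Set (ℝ × ℝ)}
    (hA : MeasurableSet A) (k : ℝ) :
    networkLaw p pr n {ω | k ≤ nodeCount ω A} ≤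
      ENNReal.ofReal (Real.exp (2 * (n * (nodeLaw p).real A) - k)) := by
  have := isProbabilityMeasure_nodeLaw hp₀ hp₁
  have h := measure_le_sum_indicator_le (A := fun i : Fin n => {x : Fin n → ℝ × ℝ | x i ∈ A})
    (fun i => measurable_pi_apply i hA)
    (iIndepFun_indicator_nodes hp₀ hp₁ hA) Finset.univ k
  rw [sum_pi_real hp₀ hp₁ hA] at h
  refine le_trans ?_ ((networkLaw_fst_preimage_le (pr := pr) _).trans h)
  refine measure_mono fun ω hω => ?_
  exact hω.trans_eq (sum_indicator_eq_nodeCount ω A).symm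

lemma networkLaw_nodeCount_le (hp₀ : 0 < p) (hp₁ : p < 1) {A : Set (ℝ × ℝ)}
    (hA : MeasurableSet A) (k : ℝ) :
    networkLaw p pr n {ω | nodeCount ω A ≤ k} ≤
      ENNReal.ofReal (Real.exp (k - n * (nodeLaw p).real A / 2)) := by
  have := isProbabilityMeasure_nodeLaw hp₀ hp₁
  have h := measure_sum_indicator_le_le (A := fun i : Fin n => {x : Fin n → ℝ × ℝ | x i ∈ A})
    (fun i => measurable_pi_apply i hA)
    (iIndepFun_indicator_nodes hp₀ hp₁ hA) Finset.univ k
  rw [sum_pi_real hp₀ hp₁ hA] at h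
  refine le_trans ?_ ((networkLaw_fst_preimage_le (pr := pr) _).trans h)
  refine measure_mono fun ω hω => ?_
  exact (sum_indicator_eq_nodeCount ω A).trans_le hω

lemma relayIntensity_nonneg (hpr₁ : pr < 1) (c : Crossing) : 0 ≤ relayIntensity pr n c := by
  have : 0 < 1 - pr := by linarith
  unfold relayIntensity; positivity

lemma infinitePi_relay_absent (hpr₁ : pr < 1) (c : Crossing) :
    Measure.infinitePi (fun c : Crossing => poissonMeasure (relayIntensity pr n c).toNNReal)
      {η | η c = 0} = ENNReal.ofReal (Real.exp (-relayIntensity pr n c)) := by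
  have h := (measurePreserving_eval_infinitePi
    (fun c : Crossing => poissonMeasure (relayIntensity pr n c).toNNReal) c).measure_preimage
    (measurableSet_singleton 0).nullMeasurableSet
  refine h.trans ?_
  rw [poissonMeasure_singleton]
  simp [relayIntensity_nonneg hpr₁ c]

lemma networkLaw_relay_absent (hp₀ : 0 < p) (hp₁ : p < 1) (hpr₁ : pr < 1) (c : Crossing) :
    networkLaw p pr n {ω | ¬ 0 < ω.2 c} ≤
      ENNReal.ofReal (Real.exp (-relayIntensity pr n c)) := by
  rw [← infinitePi_relay_absent hpr₁]
  refine le_trans (measure_mono fun ω hω => ?_) (networkLaw_snd_preimage_le hp₀ hp₁ _)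
  simpa using hω

/-- A Poisson variable of mean λ is positive with probability 1 - e^(-λ) ≤ λ. -/
lemma infinitePi_relay_present_le (hpr₁ : pr < 1) (c : Crossing) :
    (Measure.infinitePi fun c : Crossing => poissonMeasure (relayIntensity pr n c).toNNReal).real
      {η | 0 < η c} ≤ relayIntensity pr n c := by
  have h : {η : Crossing → ℕ | 0 < η c} = {η | η c = 0}ᶜ := by ext; simp [Nat.pos_iff_ne_zero]
  have hm : MeasurableSet {η : Crossing → ℕ | η c = 0} :=
    measurable_pi_apply c (measurableSet_singleton 0)
  rw [h, probReal_compl_eq_one_sub hm, measureReal_def, infinitePi_relay_absent hpr₁,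
    ENNReal.toReal_ofReal (Real.exp_pos _).le]
  linarith [Real.add_one_le_exp (-relayIntensity pr n c)]

/-- The intensity factors over the two coordinates, and each factor pr ((1 - pr)/2)^level has total
mass 1 over the lines. -/
lemma sum_relayIntensity_le (hpr₀ : 0 < pr) (hpr₁ : pr < 1) (F : Finset Crossing) :
    ∑ c ∈ F, relayIntensity pr n c ≤ n := by
  have hr : 0 < 1 - pr := by linarith
  have h := hasSum_line_one hpr₀ hpr₁
  have h1 : ∀ F' : Finset Line, ∑ b ∈ F', pr * ((1 - pr) / 2) ^ b.1 ≤ 1 := fun F' =>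
    sum_le_hasSum F' (fun b _ => by positivity) h
  calc ∑ c ∈ F, relayIntensity pr n c
      ≤ ∑ c ∈ F.image Prod.fst ×ˢ F.image Prod.snd, relayIntensity pr n c :=
        Finset.sum_le_sum_of_subset_of_nonneg Finset.subset_product
          fun c _ _ => relayIntensity_nonneg hpr₁ c
    _ = n * ((∑ b ∈ F.image Prod.fst, pr * ((1 - pr) / 2) ^ b.1) *
          ∑ b ∈ F.image Prod.snd, pr * ((1 - pr) / 2) ^ b.1) := by
        rw [Finset.sum_mul_sum, Finset.sum_product, Finset.mul_sum]
        refine Finset.sum_congr rfl fun a _ => ?_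
        rw [Finset.mul_sum]
        refine Finset.sum_congr rfl fun b _ => ?_
        rw [relayIntensity, pow_add]; ring
    _ ≤ n * (1 * 1) := by
        gcongr
        · exact h1 _
        · exact h1 _
    _ = n := by ring

/-- The expected number of relays is at most n. Chernoff's bound at 4n gives the exponent 2n - 4n
uniformly over finite sets of crossings, and continuity from below passes to all crossings. -/
lemma networkLaw_encard_relays (hp₀ : 0 < p) (hp₁ : p < 1) (hpr₀ : 0 < pr) (hpr₁ : pr < 1) :
    networkLaw p pr n {ω | ¬ {c | 0 < ω.2 c}.encard ≤ (4 * n : ℕ)} ≤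
      ENNReal.ofReal (Real.exp (-(2 * n))) := by
  set μ := Measure.infinitePi
    fun c : Crossing => poissonMeasure (relayIntensity pr n c).toNNReal with hμ
  have hA : ∀ c : Crossing, MeasurableSet {η : Crossing → ℕ | 0 < η c} := fun c =>
    measurable_pi_apply c (measurableSet_Ioi (a := 0))
  have hind : iIndepFun (fun c : Crossing =>
      {η : Crossing → ℕ | 0 < η c}.indicator (1 : (Crossing → ℕ) → ℝ)) μ :=
    iIndepFun_infinitePi (X := fun _ : Crossing => (Set.Ioi 0).indicator (1 : ℕ → ℝ))
      fun _ => measurable_one.indicator measurableSet_Ioi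
  set E : Finset Crossing → Set (Crossing → ℕ) := fun F =>
    {η | ((4 * n : ℕ) : ℝ) ≤ (∑ c ∈ F, {η : Crossing → ℕ | 0 < η c}.indicator
      (1 : (Crossing → ℕ) → ℝ)) η} with hE
  have hmono : Monotone E := by
    intro F F' hF η hη
    simp only [hE, Set.mem_ofPred_eq, Finset.sum_apply] at hη ⊢
    refine hη.trans ?_
    exact Finset.sum_le_sum_of_subset_of_nonneg hF
      fun c _ _ => Set.indicator_nonneg (fun _ _ => zero_le_one) _
  have hle : μ (⋃ F, E F) ≤ ENNReal.ofReal (Real.exp (-(2 * n))) := by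
    rw [hmono.directed_le.measure_iUnion]
    refine iSup_le fun F => (measure_le_sum_indicator_le hA hind F _).trans ?_
    refine ENNReal.ofReal_le_ofReal (Real.exp_le_exp.2 ?_)
    have := (Finset.sum_le_sum fun c (_ : c ∈ F) =>
      infinitePi_relay_present_le (n := n) hpr₁ c).trans (sum_relayIntensity_le hpr₀ hpr₁ F)
    push_cast
    linarith
  refine le_trans (measure_mono fun ω hω => ?_) ((networkLaw_snd_preimage_le hp₀ hp₁ _).trans hle)
  simp only [Set.mem_ofPred_eq, not_le] at hω
  -- Exactly 4n of the relays present form a finite set that witnesses membership in the union, even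
  -- if there are infinitely many relays.
  obtain ⟨t, ht, htc⟩ := Set.exists_subset_encard_eq hω.le
  have hfin : t.Finite := Set.finite_of_encard_eq_coe htc
  refine Set.mem_iUnion.2 ⟨hfin.toFinset, ?_⟩
  rw [hfin.encard_eq_coe_toFinset_card] at htc
  have hcard : hfin.toFinset.card = 4 * n := by exact_mod_cast htc
  simp only [hE, Set.mem_ofPred_eq, Finset.sum_apply]
  rw [← hcard, Finset.card_eq_sum_ones, Nat.cast_sum]
  refine Finset.sum_le_sum fun c hc => ?_
  rw [Set.indicator_of_mem (show ω.2 ∈ {η : Crossing → ℕ | 0 < η c} from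
    ht (hfin.mem_toFinset.1 hc))]
  simp

end Events

/-! ### Union bound over the streets, pieces and crossings up to level `L`. -/

section Union

variable {p pr : ℝ} {n : ℕ}

lemma measure_biUnion_le_card_mul {Ω ι : Type*} [MeasurableSpace Ω] (μ : Measure Ω)
    (S : Finset ι) {E : ι → Set Ω} {e : ENNReal} {N : ℕ} (hN : S.card ≤ N)
    (h : ∀ i ∈ S, μ (E i) ≤ e) : μ (⋃ i ∈ S, E i) ≤ N * e := by
  refine (measure_biUnion_finset_le S E).trans ((Finset.sum_le_card_nsmul S _ e h).trans ?_)
  rw [nsmul_eq_mul]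
  gcongr

/-- The lines of level at most `L`. -/
def lines (L : ℕ) : Finset Line := (Finset.range (L + 1)).sigma fun _ => Finset.univ

lemma mem_lines {L : ℕ} {a : Line} : a ∈ lines L ↔ a.1 ≤ L := by
  simp [lines]

lemma card_lines_le (L : ℕ) : (lines L).card ≤ 2 * 2 ^ L := by
  rw [lines, Finset.card_sigma]
  simp only [Finset.card_univ, Fintype.card_fin]
  rw [Nat.geomSum_eq le_rfl, pow_succ]
  simp only [Nat.add_one_sub_one, Nat.div_one]
  omega

/-- The streets of level at most `L`. -/
def streets (L : ℕ) : Finset Street := (lines L).disjSum (lines L)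

lemma mem_streets {L : ℕ} {s : Street} : s ∈ streets L ↔ s.level ≤ L := by
  cases s <;> simp [streets, mem_lines, Street.level]

lemma card_streets_le (L : ℕ) : (streets L).card ≤ 4 * 2 ^ L := by
  rw [streets, Finset.card_disjSum]
  linarith [card_lines_le L]

lemma measurableSet_carrier (s : Street) : MeasurableSet s.carrier :=
  s.measurableEmbedding_point.measurableSet_image' measurableSet_Icc

lemma measurableSet_piece (s : Street) (L : ℕ) (k : Fin (2 ^ L)) : MeasurableSet (s.piece L k) :=
  s.measurableEmbedding_point.measurableSet_image' measurableSet_Icc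

lemma nodeLaw_real_carrier (hp₀ : 0 < p) (hp₁ : p < 1) (s : Street) :
    (nodeLaw p).real s.carrier = p / 2 * ((1 - p) / 2) ^ s.level := by
  have hq : 0 < 1 - p := by linarith
  rw [measureReal_def, nodeLaw_carrier, ENNReal.toReal_ofReal (by positivity)]

lemma nodeLaw_real_carrier_le (hp₀ : 0 < p) (hp₁ : p < 1) (s : Street) :
    (nodeLaw p).real s.carrier ≤ 1 / 2 ^ s.level := by
  rw [nodeLaw_real_carrier hp₀ hp₁, div_pow, mul_div_assoc']
  have h1 : (1 - p) ^ s.level ≤ 1 := pow_le_one₀ (by linarith) (by linarith)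
  have h2 : 0 ≤ (1 - p) ^ s.level := pow_nonneg (by linarith) _
  gcongr
  nlinarith

lemma nodeLaw_real_piece_le (hp₀ : 0 < p) (hp₁ : p < 1) (s : Street) (L : ℕ) (k : Fin (2 ^ L)) :
    (nodeLaw p).real (s.piece L k) ≤ 1 / 2 ^ L := by
  have hq : 0 < 1 - p := by linarith
  rw [measureReal_def, Street.piece, nodeLaw_image]
  refine ENNReal.toReal_le_of_le_ofReal (by positivity) ?_
  have h1 : ENNReal.ofReal (p / 2 * ((1 - p) / 2) ^ s.level) ≤ 1 := by
    refine ENNReal.ofReal_le_one.2 ?_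
    have : ((1 - p) / 2) ^ s.level ≤ 1 := pow_le_one₀ (by positivity) (by linarith)
    have : 0 < ((1 - p) / 2) ^ s.level := by positivity
    nlinarith
  refine (mul_le_of_le_one_left' h1).trans ((measure_mono Set.inter_subset_left).trans ?_)
  rw [Real.volume_Icc]
  refine ENNReal.ofReal_le_ofReal (le_of_eq ?_)
  ring

/-- Outside an event of small probability, the network is well spread up to level `L`. -/
lemma networkLaw_not_wellSpread (hp₀ : 0 < p) (hp₁ : p < 1) (hpr₀ : 0 < pr) (hpr₁ : pr < 1)
    (hr : (1 - p) / 2 ≤ ((1 - pr) / 2) ^ 2) (L : ℕ) {M c : ℝ}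
    (hM : M ≤ p / 8 * (n * ((1 - p) / 2) ^ L)) (hc : c ≤ p / 8) (hc' : c ≤ pr ^ 2) :
    networkLaw p pr n {ω | ¬ WellSpread ω L M ⌊4 * (n / 2 ^ L : ℝ)⌋₊} ≤
      16 * 4 ^ L * ENNReal.ofReal (Real.exp (-(c * (n * ((1 - p) / 2) ^ L)))) := by
  have hq : 0 < 1 - p := by linarith
  set y : ℝ := n * ((1 - p) / 2) ^ L with hy
  set D : ℝ := n / 2 ^ L with hD
  have hy0 : 0 ≤ y := by positivity
  have hyD : y ≤ D := by
    rw [hy, hD, div_pow, mul_div_assoc']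
    have : (1 - p) ^ L ≤ 1 := pow_le_one₀ hq.le (by linarith)
    gcongr
    exact mul_le_of_le_one_right (by positivity) this
  set e : ENNReal := ENNReal.ofReal (Real.exp (-(c * y))) with he
  set P := networkLaw p pr n with hP
  have hexp : ∀ u : ℝ, u ≤ -(c * y) → ENNReal.ofReal (Real.exp u) ≤ e := fun u hu =>
    ENNReal.ofReal_le_ofReal (Real.exp_le_exp.2 hu)
  -- The mean is at most D, so the threshold 4D leaves the exponent -2D, which is below -cy because
  -- y ≤ D.
  have hupper : ∀ A : Set (ℝ × ℝ), MeasurableSet A → (nodeLaw p).real A ≤ 1 / 2 ^ L →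
      P {ω | 4 * D ≤ nodeCount ω A} ≤ e := fun A hA hA' => by
    refine (networkLaw_le_nodeCount hp₀ hp₁ hA _).trans (hexp _ ?_)
    have h1 : n * (nodeLaw p).real A ≤ D := by
      rw [hD, div_eq_mul_one_div]; gcongr
    nlinarith
  -- The mean is at least py/2, so half of it exceeds the threshold M ≤ py/8 by at least py/8.
  have h1 : P (⋃ s ∈ streets L, {ω | nodeCount ω s.carrier ≤ M}) ≤ (4 * 2 ^ L : ℕ) * e := by
    refine measure_biUnion_le_card_mul _ _ (card_streets_le L) fun s hs => ?_
    refine (networkLaw_nodeCount_le hp₀ hp₁ (measurableSet_carrier s) M).trans (hexp _ ?_)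
    rw [nodeLaw_real_carrier hp₀ hp₁]
    have h2 : ((1 - p) / 2) ^ L ≤ ((1 - p) / 2) ^ s.level :=
      pow_le_pow_of_le_one (by positivity) (by linarith) (mem_streets.1 hs)
    have h3 : y ≤ n * ((1 - p) / 2) ^ s.level := by rw [hy]; gcongr
    nlinarith
  have h2 : P (⋃ x ∈ streets L ×ˢ (Finset.univ : Finset (Fin (2 ^ L))),
      {ω | 4 * D ≤ nodeCount ω (x.1.piece L x.2)}) ≤ (4 * 2 ^ L * 2 ^ L : ℕ) * e := by
    refine measure_biUnion_le_card_mul _ _ ?_ fun x _ =>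
      hupper _ (measurableSet_piece _ _ _) (nodeLaw_real_piece_le hp₀ hp₁ _ _ _)
    rw [Finset.card_product, Finset.card_univ, Fintype.card_fin]
    exact Nat.mul_le_mul_right _ (card_streets_le L)
  have h3 : P (⋃ s ∈ (streets L).filter fun s => s.level = L,
      {ω | 4 * D ≤ nodeCount ω s.carrier}) ≤ (4 * 2 ^ L : ℕ) * e := by
    refine measure_biUnion_le_card_mul _ _
      ((Finset.card_filter_le _ _).trans (card_streets_le L)) fun s hs =>
      hupper _ (measurableSet_carrier s) ?_
    have := nodeLaw_real_carrier_le hp₀ hp₁ s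
    rwa [(Finset.mem_filter.1 hs).2] at this
  have h4 : P (⋃ x ∈ lines L ×ˢ lines L, {ω | ¬ 0 < ω.2 x}) ≤
      ((2 * 2 ^ L) * (2 * 2 ^ L) : ℕ) * e := by
    refine measure_biUnion_le_card_mul _ _ ?_ fun x hx =>
      (networkLaw_relay_absent hp₀ hp₁ hpr₁ x).trans (hexp _ (neg_le_neg ?_))
    · rw [Finset.card_product]
      exact Nat.mul_le_mul (card_lines_le L) (card_lines_le L)
    · obtain ⟨hx1, hx2⟩ := Finset.mem_product.1 hx
      -- Both streets have level at most L, so the relay exponent is at most 2L; `hr` compares the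
      -- two bases.
      have h5 : ((1 - p) / 2) ^ L ≤ ((1 - pr) / 2) ^ (x.1.1 + x.2.1) := by
        refine (pow_le_pow_left₀ (by positivity) hr L).trans ?_
        rw [← pow_mul]
        refine pow_le_pow_of_le_one (by linarith) (by linarith) ?_
        have := mem_lines.1 hx1
        have := mem_lines.1 hx2
        omega
      calc c * y ≤ pr ^ 2 * y := by gcongr
        _ = n * pr ^ 2 * ((1 - p) / 2) ^ L := by rw [hy]; ring
        _ ≤ relayIntensity pr n x := by unfold relayIntensity; gcongr
  have hsub : {ω | ¬ WellSpread ω L M ⌊4 * D⌋₊} ⊆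
      ((⋃ s ∈ streets L, {ω : Config n | nodeCount ω s.carrier ≤ M}) ∪
        ⋃ x ∈ streets L ×ˢ (Finset.univ : Finset (Fin (2 ^ L))),
          {ω | 4 * D ≤ nodeCount ω (x.1.piece L x.2)}) ∪
      ((⋃ s ∈ (streets L).filter fun s => s.level = L, {ω | 4 * D ≤ nodeCount ω s.carrier}) ∪
        ⋃ x ∈ lines L ×ˢ lines L, {ω | ¬ 0 < ω.2 x}) := by
    intro ω hω
    by_contra hno
    simp only [Set.mem_union, Set.mem_iUnion, not_or, not_exists] at hno
    obtain ⟨⟨g1, g2⟩, g3, g4⟩ := hno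
    refine hω ⟨fun s hs => ?_, fun x hx hx' => ?_, fun s hs k => ?_, fun s hs => ?_⟩
    · exact (not_le.1 (g1 s (mem_streets.2 hs))).le
    · exact not_not.1 (g4 x (Finset.mem_product.2 ⟨mem_lines.2 hx, mem_lines.2 hx'⟩))
    · exact Nat.le_floor
        (not_le.1 (g2 (s, k) (Finset.mem_product.2 ⟨mem_streets.2 hs, Finset.mem_univ _⟩))).le
    · exact Nat.le_floor
        (not_le.1 (g3 s (Finset.mem_filter.2 ⟨mem_streets.2 hs.le, hs⟩))).le
  refine (measure_mono hsub).trans ((measure_union_le _ _).trans ((add_le_add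
    ((measure_union_le _ _).trans (add_le_add h1 h2))
    ((measure_union_le _ _).trans (add_le_add h3 h4))).trans ?_))
  rw [← add_mul, ← add_mul, ← add_mul]
  gcongr
  have h5 : 4 * 2 ^ L + 4 * 2 ^ L * 2 ^ L + (4 * 2 ^ L + 2 * 2 ^ L * (2 * 2 ^ L)) ≤ 16 * 4 ^ L := by
    rw [show 4 ^ L = 2 ^ L * 2 ^ L by rw [← mul_pow]; norm_num]
    nlinarith [Nat.one_le_two_pow (n := L)]
  exact_mod_cast h5

end Union

/-! ### Asymptotics -/

section Asymptotics

variable {p pr : ℝ}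

/-- L is the last exponent at which the power of x is still at least K n^(-α). It tends to infinity
because x^(L+1) is squeezed to 0. -/
lemma exists_level {x α K : ℝ} (hx₀ : 0 < x) (hx₁ : x < 1) (hα : 0 < α) (hK : 0 < K) :
    ∃ L : ℕ → ℕ, Tendsto L atTop atTop ∧ ∀ᶠ n : ℕ in atTop,
      K * (n : ℝ) ^ (-α) ≤ x ^ L n ∧ x ^ (L n + 1) < K * (n : ℝ) ^ (-α) := by
  have hlim : Tendsto (fun n : ℕ => K * (n : ℝ) ^ (-α)) atTop (𝓝 0) := by
    simpa using ((tendsto_rpow_neg_atTop hα).comp tendsto_natCast_atTop_atTop).const_mul K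
  have hex : ∀ n : ℕ, ∃ l : ℕ, 0 < n → K * (n : ℝ) ^ (-α) < 1 →
      K * (n : ℝ) ^ (-α) ≤ x ^ l ∧ x ^ (l + 1) < K * (n : ℝ) ^ (-α) := fun n => by
    by_cases hn : 0 < n ∧ K * (n : ℝ) ^ (-α) < 1
    · have hn0 : (0 : ℝ) < n := by exact_mod_cast hn.1
      obtain ⟨l, h1, h2⟩ := exists_nat_pow_near_of_lt_one
        (show 0 < K * (n : ℝ) ^ (-α) by positivity) hn.2.le hx₀ hx₁
      exact ⟨l, fun _ _ => ⟨h2, h1⟩⟩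
    -- A dummy level for the finitely many n at which the target is not in (0, 1).
    · exact ⟨0, fun h1 h2 => absurd ⟨h1, h2⟩ hn⟩
  choose L hL using hex
  have hev : ∀ᶠ n : ℕ in atTop,
      K * (n : ℝ) ^ (-α) ≤ x ^ L n ∧ x ^ (L n + 1) < K * (n : ℝ) ^ (-α) := by
    filter_upwards [eventually_gt_atTop 0, hlim.eventually_lt_const one_pos] with n hn hn'
    exact hL n hn hn'
  refine ⟨L, tendsto_atTop.2 fun k => ?_, hev⟩
  filter_upwards [hev, hlim.eventually_lt_const (show 0 < x ^ k by positivity)] with n hn hn'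
  have h1 := (pow_lt_pow_iff_right_of_lt_one₀ hx₀ hx₁).1 (hn.2.trans hn')
  omega

lemma tendsto_mul_exp_neg_rpow {a b : ℝ} (ha : 0 < a) (hb : 0 < b) :
    Tendsto (fun n : ℕ => (n : ℝ) * Real.exp (-(a * (n : ℝ) ^ b))) atTop (𝓝 0) := by
  have h := ((tendsto_rpow_mul_exp_neg_mul_atTop_nhds_zero (1 / b) a ha).comp
    (tendsto_rpow_atTop hb)).comp tendsto_natCast_atTop_atTop
  refine h.congr fun n => ?_
  simp only [Function.comp_apply]
  rw [← Real.rpow_mul (Nat.cast_nonneg n), mul_one_div_cancel hb.ne', Real.rpow_one, neg_mul]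

lemma tendsto_exp_neg_rpow {a b : ℝ} (ha : 0 < a) (hb : 0 < b) :
    Tendsto (fun n : ℕ => Real.exp (-(a * (n : ℝ) ^ b))) atTop (𝓝 0) :=
  Real.tendsto_exp_neg_atTop_nhds_zero.comp
    (((tendsto_rpow_atTop hb).comp tendsto_natCast_atTop_atTop).const_mul_atTop ha)

lemma tendsto_exp_neg_mul {a : ℝ} (ha : 0 < a) :
    Tendsto (fun n : ℕ => Real.exp (-(a * (n : ℝ)))) atTop (𝓝 0) := by
  simpa using tendsto_exp_neg_rpow ha one_pos

lemma nodeDim_sub_one_mul (hp₁ : p < 1) :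
    (nodeDim p - 1) * Real.log 2 = -Real.log ((1 - p) / 2) := by
  have hq : 0 < 1 - p := by linarith
  have h2 : Real.log 2 ≠ 0 := (Real.log_pos one_lt_two).ne'
  rw [nodeDim, sub_mul, div_mul_cancel₀ _ h2, one_mul, Real.log_div four_ne_zero hq.ne',
    Real.log_div hq.ne' two_ne_zero, show (4 : ℝ) = 2 ^ 2 by norm_num, Real.log_pow]
  push_cast; ring

lemma lt_half_of_nodeDim (hp₁ : p < 1) (hdF : 3 < nodeDim p) : 1 - p < 1 / 2 := by
  have hq : 0 < 1 - p := by linarith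
  have h2 : 0 < Real.log 2 := Real.log_pos one_lt_two
  have h := nodeDim_sub_one_mul hp₁
  have h1 : Real.log ((1 - p) / 2) < Real.log ((1 / 2) ^ 2) := by
    rw [Real.log_pow, one_div, Real.log_inv]
    push_cast
    nlinarith
  have := (Real.log_lt_log_iff (by positivity) (by positivity)).1 h1
  linarith

/-- The dimension gap in multiplicative form: along two streets of equal level, relay intensities
decay more slowly than node densities. -/
lemma lt_sq_of_relayDim (hp₁ : p < 1) (hpr₁ : pr < 1) (hdr : relayDim pr < nodeDim p - 1) :
    (1 - p) / 2 < ((1 - pr) / 2) ^ 2 := by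
  have hq : 0 < 1 - p := by linarith
  have hq' : 0 < 1 - pr := by linarith
  have h2 : 0 < Real.log 2 := Real.log_pos one_lt_two
  have h := nodeDim_sub_one_mul hp₁
  have h1 : relayDim pr * Real.log 2 = -(2 * Real.log ((1 - pr) / 2)) := by
    rw [relayDim, mul_assoc, div_mul_cancel₀ _ h2.ne', ← inv_div, Real.log_inv]
    ring
  refine (Real.log_lt_log_iff (by positivity) (by positivity)).1 ?_
  rw [Real.log_pow]
  push_cast
  nlinarith

lemma two_pow_rpow_nodeDim (hp₁ : p < 1) (L : ℕ) :
    ((2 : ℝ) ^ L) ^ (nodeDim p - 1) = (((1 - p) / 2) ^ L)⁻¹ := by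
  have hq : 0 < 1 - p := by linarith
  rw [← Real.rpow_natCast, ← Real.rpow_mul two_pos.le, mul_comm, Real.rpow_mul two_pos.le,
    Real.rpow_natCast, Real.rpow_def_of_pos two_pos, mul_comm, nodeDim_sub_one_mul hp₁,
    Real.exp_neg, Real.exp_log (by positivity), inv_pow]

/-! ### Typical and balanced configurations. -/

/-- A vertical street of level `0`. -/
def centralStreet : Street := Sum.inl ⟨0, 0⟩

/-- The typical configurations, up to the level `L`. -/
structure Typical {n : ℕ} (ω : Config n) (L : ℕ) (M : ℝ) : Prop where
  wellSpread : WellSpread ω L M ⌊4 * (n / 2 ^ L : ℝ)⌋₊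
  nodeCount_le : nodeCount ω (goodSet L)ᶜ ≤ (n / 2 ^ L : ℝ)

/-- The configurations with at most `4 n` relays and with a positive fraction of the nodes
on the central street. -/
structure Balanced (p : ℝ) {n : ℕ} (ω : Config n) : Prop where
  encard_relays_le : {c | 0 < ω.2 c}.encard ≤ (4 * n : ℕ)
  le_streetCount : p * n / 8 ≤ streetCount ω centralStreet

lemma tendsto_networkLaw_not_balanced (hp₀ : 0 < p) (hp₁ : p < 1) (hpr₀ : 0 < pr)
    (hpr₁ : pr < 1) :
    Tendsto (fun n : ℕ => networkLaw p pr n {ω | ¬ Balanced p ω}) atTop (𝓝 0) := by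
  have hle : ∀ n : ℕ, networkLaw p pr n {ω | ¬ Balanced p ω} ≤
      ENNReal.ofReal (Real.exp (-(2 * n)) + Real.exp (-(p / 8 * n))) := fun n => by
    rw [ENNReal.ofReal_add (Real.exp_pos _).le (Real.exp_pos _).le]
    -- The threshold is a quarter of the mean pn/2, which leaves the exponent -pn/8.
    have h2 := networkLaw_nodeCount_le (pr := pr) (n := n) hp₀ hp₁
      (measurableSet_carrier centralStreet) (p * n / 8)
    rw [nodeLaw_real_carrier hp₀ hp₁, show centralStreet.level = 0 from rfl, pow_zero,
      show p * n / 8 - n * (p / 2 * 1) / 2 = -(p / 8 * n) by ring] at h2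
    refine (measure_mono fun ω hω => ?_).trans ((measure_union_le _ _).trans (add_le_add
      (networkLaw_encard_relays hp₀ hp₁ hpr₀ hpr₁) h2))
    by_contra hno
    rw [Set.mem_union, not_or] at hno
    exact hω ⟨not_not.1 hno.1, (not_le.1 hno.2).le⟩
  refine tendsto_of_tendsto_of_tendsto_of_le_of_le tendsto_const_nhds ?_ (fun _ => zero_le)
    hle
  rw [← ENNReal.ofReal_zero]
  refine (ENNReal.continuous_ofReal.tendsto 0).comp ?_
  simpa using (tendsto_exp_neg_mul two_pos).add
    (tendsto_exp_neg_mul (show 0 < p / 8 by positivity))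

/-- The factor 8/p in the choice of L turns n x^L ≥ (8K/p) n^(1-α) into the street count K n^(1-α).
As x < 1/4 and eventually n x^L ≥ 1, also 4^L ≤ n, so the union bound costs a factor of only 16n
against exp(-const · n^(1-α)). -/
lemma exists_typical (hp₀ : 0 < p) (hp₁ : p < 1) (hpr₀ : 0 < pr) (hpr₁ : pr < 1)
    (hdF : 3 < nodeDim p) (hdr : relayDim pr < nodeDim p - 1) {α K : ℝ} (hα₀ : 0 < α)
    (hα₁ : α < 1) (hK : 0 < K) :
    ∃ L : ℕ → ℕ, Tendsto L atTop atTop ∧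
      (∃ A > 0, ∀ᶠ n : ℕ in atTop,
        (n : ℝ) ^ (α / (nodeDim p - 1)) ≤ A * 2 ^ L n ∧ 1 ≤ (n / 2 ^ L n : ℝ)) ∧
      Tendsto (fun n : ℕ => networkLaw p pr n
        {ω | ¬ Typical ω (L n) (K * (n : ℝ) ^ (1 - α))}) atTop (𝓝 0) := by
  have hq : 0 < 1 - p := by linarith
  have hq2 := lt_half_of_nodeDim hp₁ hdF
  have hr := lt_sq_of_relayDim hp₁ hpr₁ hdr
  set x : ℝ := (1 - p) / 2 with hx
  have hx₀ : 0 < x := by positivity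
  have hx₁ : x < 1 / 4 := by rw [hx]; linarith
  have hθ : 0 < nodeDim p - 1 := by linarith
  obtain ⟨L, hLtop, hL⟩ := exists_level hx₀ (by linarith) hα₀ (show 0 < 8 * K / p by positivity)
  have hone : ∀ᶠ n : ℕ in atTop, 1 ≤ 8 * K / p * (n : ℝ) ^ (1 - α) := by
    refine Tendsto.eventually_ge_atTop ?_ 1
    exact ((tendsto_rpow_atTop (by linarith)).comp tendsto_natCast_atTop_atTop).const_mul_atTop
      (by positivity)
  have hLn : ∀ᶠ n : ℕ in atTop, 0 < n ∧ 8 * K / p * (n : ℝ) ^ (1 - α) ≤ n * x ^ L n ∧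
      n * x ^ L n ≤ (n / 2 ^ L n : ℝ) ∧ (4 : ℝ) ^ L n ≤ n ∧ 1 ≤ n * x ^ L n := by
    filter_upwards [eventually_gt_atTop 0, hL, hone] with n hn h1 h2
    have hn0 : (0 : ℝ) < n := by exact_mod_cast hn
    have h3 : 8 * K / p * (n : ℝ) ^ (1 - α) ≤ n * x ^ L n := by
      rw [sub_eq_add_neg, Real.rpow_add hn0, Real.rpow_one]
      nlinarith [h1.1]
    refine ⟨hn, h3, ?_, ?_, h2.trans h3⟩
    · rw [div_eq_mul_inv, ← inv_pow]
      gcongr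
      linarith
    · calc (4 : ℝ) ^ L n ≤ 4 ^ L n * (n * x ^ L n) :=
            le_mul_of_one_le_right (by positivity) (h2.trans h3)
        _ = n * (4 * x) ^ L n := by rw [mul_pow]; ring
        _ ≤ n * 1 := by gcongr; exact pow_le_one₀ (by positivity) (by linarith)
        _ = n := mul_one _
  -- Maximality of L controls 2^(L+1) rather than 2^L, hence the factor 2.
  refine ⟨L, hLtop, ⟨2 * (8 * K / p) ^ (1 / (nodeDim p - 1)), by positivity, ?_⟩, ?_⟩
  · filter_upwards [hLn, hL] with n hn h1
    refine ⟨?_, hn.2.2.2.2.trans hn.2.2.1⟩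
    have hn0 : (0 : ℝ) < n := by exact_mod_cast hn.1
    have h2 : (n : ℝ) ^ α ≤ 8 * K / p * ((2 : ℝ) ^ (L n + 1)) ^ (nodeDim p - 1) := by
      rw [two_pow_rpow_nodeDim hp₁, ← hx, ← div_eq_mul_inv, le_div_iff₀ (by positivity)]
      have h3 := h1.2.le
      rw [Real.rpow_neg hn0.le, ← div_eq_mul_inv, le_div_iff₀ (by positivity)] at h3
      linarith
    calc (n : ℝ) ^ (α / (nodeDim p - 1)) = ((n : ℝ) ^ α) ^ (1 / (nodeDim p - 1)) := by
          rw [← Real.rpow_mul hn0.le, mul_one_div]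
      _ ≤ (8 * K / p * ((2 : ℝ) ^ (L n + 1)) ^ (nodeDim p - 1)) ^ (1 / (nodeDim p - 1)) := by
          gcongr
      _ = 2 * (8 * K / p) ^ (1 / (nodeDim p - 1)) * 2 ^ L n := by
          rw [Real.mul_rpow (by positivity) (by positivity), ← Real.rpow_mul (by positivity),
            mul_one_div_cancel hθ.ne', Real.rpow_one, pow_succ]
          ring
  · set c : ℝ := min (p / 8) (pr ^ 2) with hc
    have hc0 : 0 < c := lt_min (by positivity) (by positivity)
    -- Since 1 - p < 1/2, eventually twice the expected number of nodes off the good streets is at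
    -- most half of n/2^L; Chernoff's bound then has exponent at most -n/2^(L+1).
    have hsmall : ∀ᶠ n : ℕ in atTop, 4 * (1 - p) * (2 * (1 - p)) ^ L n ≤ 1 := by
      have h : Tendsto (fun n : ℕ => 4 * (1 - p) * (2 * (1 - p)) ^ L n) atTop (𝓝 0) := by
        simpa using ((tendsto_pow_atTop_nhds_zero_of_lt_one (by positivity)
          (show 2 * (1 - p) < 1 by linarith)).comp hLtop).const_mul (4 * (1 - p))
      exact h.eventually_le_const one_pos
    have hle : ∀ᶠ n : ℕ in atTop, networkLaw p pr n
        {ω | ¬ Typical ω (L n) (K * (n : ℝ) ^ (1 - α))} ≤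
        ENNReal.ofReal (16 * (n * Real.exp (-(c * (8 * K / p) * (n : ℝ) ^ (1 - α)))) +
          Real.exp (-(1 / 2 * (8 * K / p) * (n : ℝ) ^ (1 - α)))) := by
      filter_upwards [hLn, hsmall] with n ⟨hn, h1, h2, h3, h4⟩ h5
      have hn0 : (0 : ℝ) < n := by exact_mod_cast hn
      have hws := networkLaw_not_wellSpread (n := n) hp₀ hp₁ hpr₀ hpr₁ hr.le (L n)
        (M := K * (n : ℝ) ^ (1 - α)) (c := c) (by
          calc K * (n : ℝ) ^ (1 - α) = p / 8 * (8 * K / p * (n : ℝ) ^ (1 - α)) := by field_simp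
            _ ≤ _ := by gcongr) (min_le_left _ _) (min_le_right _ _)
      have hgood := networkLaw_le_nodeCount (pr := pr) (n := n) hp₀ hp₁
        (measurableSet_goodSet (L n)).compl (n / 2 ^ L n)
      rw [ENNReal.ofReal_add (by positivity) (Real.exp_pos _).le]
      refine (measure_mono fun ω hω => ?_).trans ((measure_union_le _ _).trans (add_le_add
        (hws.trans ?_) (hgood.trans ?_)))
      · by_contra hno
        rw [Set.mem_union, not_or] at hno
        exact hω ⟨not_not.1 hno.1, (not_le.1 hno.2).le⟩
      · have h6 : (16 * 4 ^ L n : ENNReal) ≤ ENNReal.ofReal (16 * n) := by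
          rw [ENNReal.ofReal_mul (by positivity), ENNReal.ofReal_ofNat]
          gcongr
          rw [← ENNReal.ofReal_ofNat, ← ENNReal.ofReal_pow (by positivity)]
          exact ENNReal.ofReal_le_ofReal h3
        have h7 : Real.exp (-(c * (n * ((1 - p) / 2) ^ L n))) ≤
            Real.exp (-(c * (8 * K / p) * (n : ℝ) ^ (1 - α))) := by
          rw [Real.exp_le_exp, neg_le_neg_iff, mul_assoc]
          exact mul_le_mul_of_nonneg_left h1 hc0.le
        refine (mul_le_mul' h6 (ENNReal.ofReal_le_ofReal h7)).trans_eq ?_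
        rw [← ENNReal.ofReal_mul (by positivity), mul_assoc]
      · refine ENNReal.ofReal_le_ofReal (Real.exp_le_exp.2 ?_)
        have h6 : (nodeLaw p).real (goodSet (L n))ᶜ ≤ (1 - p) ^ (L n + 1) :=
          ENNReal.toReal_le_of_le_ofReal (by positivity)
            (nodeLaw_compl_goodSet_le hp₀ hp₁ (L n))
        have h7 : 2 * (n * (1 - p) ^ (L n + 1)) ≤ 1 / 2 * (n / 2 ^ L n : ℝ) := by
          rw [mul_div_assoc', le_div_iff₀ (by positivity)]
          calc 2 * (n * (1 - p) ^ (L n + 1)) * 2 ^ L n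
              = 1 / 2 * n * (4 * (1 - p) * (2 * (1 - p)) ^ L n) := by
                rw [mul_pow, pow_succ]; ring
            _ ≤ 1 / 2 * n * 1 := by gcongr
            _ = 1 / 2 * n := mul_one _
        have h8 : (n : ℝ) * (nodeLaw p).real (goodSet (L n))ᶜ ≤ n * (1 - p) ^ (L n + 1) := by
          gcongr
        linarith
    refine tendsto_of_tendsto_of_tendsto_of_le_of_le' tendsto_const_nhds ?_
      (Eventually.of_forall fun _ => zero_le) hle
    rw [← ENNReal.ofReal_zero]
    refine (ENNReal.continuous_ofReal.tendsto 0).comp ?_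
    simpa using ((tendsto_mul_exp_neg_rpow (show 0 < c * (8 * K / p) by positivity)
      (show 0 < 1 - α by linarith)).const_mul 16).add
      (tendsto_exp_neg_rpow (show 0 < 1 / 2 * (8 * K / p) by positivity)
      (show 0 < 1 - α by linarith))

end Asymptotics

/-! ### The throughput capacity -/

section Main

variable {p pr δ Pmax α B C : ℝ} {n : ℕ} {ω : Config n} {κ : Criterion}

lemma Balanced.le_ncard_component (h : Balanced p ω) (hB : 0 ≤ B) :
    p * n / 8 ≤ (component δ Pmax κ 1 B ω).ncard :=
  h.le_streetCount.trans (by exact_mod_cast streetCount_le_ncard_component hB rfl 1)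

lemma Balanced.le_throughput (h : Balanced p ω) (hp₀ : 0 < p) (hP : 0 ≤ Pmax) (hB : 0 ≤ B)
    (hn : 0 < n) (hC : 0 ≤ C) :
    p / 40 * C ≤ throughput δ Pmax κ B (fun _ => C) ω := by
  have hn0 : (0 : ℝ) < n := by exact_mod_cast hn
  refine le_trans (le_of_eq ?_) (Hyperfractal.le_throughput hB hC (by positivity)
    (h.le_ncard_component hB) (sum_hopCount_le_cube hP h.encard_relays_le))
  push_cast
  field_simp
  ring

lemma Typical.le_throughput {L : ℕ} {M : ℝ} (h : Typical ω L M) (h' : Balanced p ω) (hp₀ : 0 < p)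
    (hP : 0 ≤ Pmax) (hδ : 1 ≤ δ) (hM : 0 < M) (hB : WellSpread.Affordable δ Pmax M B κ)
    (hB₀ : 0 ≤ B) (hD : 1 ≤ (n / 2 ^ L : ℝ)) (hC : 0 ≤ C) :
    p / 288 * C * 2 ^ L ≤ throughput δ Pmax κ B (fun _ => C) ω := by
  have hn0 : (0 : ℝ) < n := by
    by_contra hno
    have : (n : ℝ) / 2 ^ L ≤ 0 := div_nonpos_of_nonpos_of_nonneg (not_lt.1 hno) (by positivity)
    linarith
  set D : ℝ := n / 2 ^ L with hDdef
  have hS : (n : ℝ) ^ 2 * (5 * ((⌊4 * D⌋₊ : ℝ) + 1) + 1) +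
      2 * n * nodeCount ω (goodSet L)ᶜ * (n + (4 * n : ℕ)) ≤ 36 * n ^ 2 * D := by
    -- As D ≥ 1, 5(4D + 1) + 1 ≤ 26D. The exceptional pairs add 2nD · 5n = 10n²D, for a total of
    -- 36n²D; with pn/8 nodes in the component this gives p/288.
    have h1 : (⌊4 * D⌋₊ : ℝ) ≤ 4 * D := Nat.floor_le (by positivity)
    have h2 := h.nodeCount_le
    calc _ ≤ (n : ℝ) ^ 2 * (26 * D) + 2 * n * D * (n + (4 * n : ℕ)) := by
          gcongr
          linarith
      _ = 36 * n ^ 2 * D := by push_cast; ring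
  refine le_trans (le_of_eq ?_) (Hyperfractal.le_throughput hB₀ hC (by positivity)
    (h'.le_ncard_component hB₀)
    ((h.wellSpread.sum_hopCount_le hP hδ hM hB h'.encard_relays_le).trans hS))
  rw [hDdef]
  field_simp
  ring

lemma Typical.le_ncard_joinedPairs {L : ℕ} {M : ℝ} (h : Typical ω L M)
    (hP : 0 ≤ Pmax) (hδ : 1 ≤ δ) (hM : 0 < M) (hB : WellSpread.Affordable δ Pmax M B κ) :
    (1 - 2 / 2 ^ L) * (n : ℝ) ^ 2 ≤ (joinedPairs δ Pmax κ B ω).ncard := by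
  refine le_trans ?_ (h.wellSpread.le_ncard_joinedPairs hP hδ hM hB)
  have h1 := mul_le_mul_of_nonneg_left h.nodeCount_le (show (0 : ℝ) ≤ 2 * n by positivity)
  have h2 : (1 - 2 / 2 ^ L) * (n : ℝ) ^ 2 = (n : ℝ) ^ 2 - 2 * n * (n / 2 ^ L) := by ring
  linarith

/-- A budget of order `budgetOrder` suffices for streets with at least `K n ^ (1 - α)` nodes, for a
large constant `K`. -/
lemma exists_affordable (hδ : 2 ≤ δ) (hPmax : 0 < Pmax) {c : ℝ} (hc : 0 < c) :
    ∃ K > 0, ∀ n : ℕ, 0 < n → ∀ B : ℝ, c * budgetOrder δ Pmax α κ n ≤ B →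
      WellSpread.Affordable δ Pmax (K * (n : ℝ) ^ (1 - α)) B κ := by
  -- With K ≥ 1 and δ ≥ 2, both exponents 1 - δ and -δ are at most -1, so 10 K^u ≤ 10/K ≤ c.
  set K : ℝ := max 1 (10 / c) with hK
  have hK1 : 1 ≤ K := le_max_left _ _
  have hK0 : 0 < K := by linarith
  have hKc : 10 * K⁻¹ ≤ c := by
    rw [← div_eq_mul_inv, div_le_iff₀ hK0, ← div_le_iff₀' hc]
    exact le_max_right _ _
  have hpow : ∀ u : ℝ, u ≤ -1 → 10 * K ^ u ≤ c := fun u hu => by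
    refine le_trans ?_ hKc
    rw [← Real.rpow_neg_one]
    gcongr
  refine ⟨K, hK0, fun n hn B hB => ?_⟩
  have hn0 : (0 : ℝ) < n := by exact_mod_cast hn
  have hsplit : ∀ u : ℝ, (K * (n : ℝ) ^ (1 - α)) ^ u = K ^ u * (n : ℝ) ^ (u * (1 - α)) := fun u => by
    rw [Real.mul_rpow hK0.le (by positivity), ← Real.rpow_mul hn0.le, mul_comm u]
  cases κ
  · refine le_trans ?_ hB
    simp only [budgetOrder, hsplit]
    have h1 := hpow (1 - δ) (by linarith)
    have h2 : 0 ≤ (n : ℝ) ^ ((1 - δ) * (1 - α)) * Pmax := by positivity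
    nlinarith [mul_le_mul_of_nonneg_right h1 h2]
  · refine le_trans ?_ hB
    simp only [budgetOrder, hsplit]
    have h1 := hpow (-δ) (by linarith)
    have h2 : 0 ≤ (n : ℝ) ^ (-δ * (1 - α)) * Pmax := by positivity
    have h3 : 0 ≤ K ^ (-δ) := by positivity
    nlinarith [mul_le_mul_of_nonneg_right (show K ^ (-δ) ≤ c by linarith) h2]

/-- A lower bound outside events of vanishing probability holds with probability tending
to `1`, and up to a factor in mean. -/
lemma tendsto_and_eventually_le_lintegral {Ω : ℕ → Type*} [∀ n, MeasurableSpace (Ω n)]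
    {P : ∀ n, Measure (Ω n)} [∀ n, IsProbabilityMeasure (P n)] {bad : ∀ n, Set (Ω n)}
    (hbad : Tendsto (fun n => P n (bad n)) atTop (𝓝 0)) {f : ∀ n, Ω n → ℝ} {v : ℕ → ℝ}
    (hv : ∀ n, 0 ≤ v n) (h : ∀ᶠ n in atTop, ∀ ω ∉ bad n, v n ≤ f n ω) :
    Tendsto (fun n => P n {ω | f n ω < v n / 2}) atTop (𝓝 0) ∧
      ∀ᶠ n in atTop, ENNReal.ofReal (v n / 2) ≤ ∫⁻ ω, ENNReal.ofReal (f n ω) ∂(P n) := by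
  constructor
  · refine tendsto_of_tendsto_of_tendsto_of_le_of_le' tendsto_const_nhds hbad
      (Eventually.of_forall fun _ => zero_le) ?_
    filter_upwards [h] with n hn
    refine measure_mono fun ω hω => ?_
    by_contra hno
    have h1 := hn ω hno
    have h2 : f n ω < v n / 2 := hω
    linarith [hv n]
  · filter_upwards [h, hbad.eventually_le_const (show (0 : ENNReal) < 2⁻¹ by simp)] with n hn hn'
    -- The bad set need not be measurable, so it is enlarged to a measurable set of the same
    -- measure.
    set E := (toMeasurable (P n) (bad n))ᶜ with hE
    have hEm : MeasurableSet E := (measurableSet_toMeasurable _ _).compl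
    have hPE : 2⁻¹ ≤ P n E := by
      rw [hE, prob_compl_eq_one_sub (measurableSet_toMeasurable _ _), measure_toMeasurable]
      refine le_trans (le_of_eq ?_) (tsub_le_tsub_left hn' 1)
      exact (ENNReal.one_sub_inv_two).symm
    calc ENNReal.ofReal (v n / 2) = ENNReal.ofReal (v n) * 2⁻¹ := by
          rw [div_eq_mul_inv, ENNReal.ofReal_mul (hv n), ENNReal.ofReal_inv_of_pos two_pos,
            ENNReal.ofReal_ofNat]
      _ ≤ ENNReal.ofReal (v n) * P n E := by gcongr
      _ = ∫⁻ ω, E.indicator (fun _ => ENNReal.ofReal (v n)) ω ∂(P n) :=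
          (lintegral_indicator_const hEm _).symm
      _ ≤ _ := by
          refine lintegral_mono fun ω => ?_
          by_cases hω : ω ∈ E
          · rw [Set.indicator_of_mem hω]
            exact ENNReal.ofReal_le_ofReal (hn ω fun hb => hω (subset_toMeasurable _ _ hb))
          · rw [Set.indicator_of_notMem hω]
            exact zero_le

lemma tendsto_measure_union_zero {Ω : ℕ → Type*} [∀ n, MeasurableSpace (Ω n)]
    {P : ∀ n, Measure (Ω n)} {E F : ∀ n, Set (Ω n)}
    (hE : Tendsto (fun n => P n (E n)) atTop (𝓝 0))
    (hF : Tendsto (fun n => P n (F n)) atTop (𝓝 0)) :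
    Tendsto (fun n => P n (E n ∪ F n)) atTop (𝓝 0) :=
  tendsto_of_tendsto_of_tendsto_of_le_of_le tendsto_const_nhds
    (by simpa using hE.add hF) (fun _ => zero_le) fun _ => measure_union_le _ _

/-- One bad event serves all rates C and all ε, so the final constant does not depend on C. -/
lemma exists_throughput_bound (hp₀ : 0 < p) (hp₁ : p < 1) (hpr₀ : 0 < pr) (hpr₁ : pr < 1)
    (hδ : 2 ≤ δ) (hPmax : 0 < Pmax) (hα : α < 1) (hdF : 3 < nodeDim p)
    (hdr : relayDim pr < nodeDim p - 1) (κ : Criterion) (B : ℕ → ℝ)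
    (hB : ∃ c > 0, ∀ᶠ n in atTop, c * budgetOrder δ Pmax α κ n ≤ B n) :
    ∃ (bad : ∀ n : ℕ, Set (Config n)) (c : ℝ), 0 < c ∧
      Tendsto (fun n => networkLaw p pr n (bad n)) atTop (𝓝 0) ∧
      (∀ᶠ n : ℕ in atTop, ∀ C > 0, ∀ ω ∉ bad n, c * (C * (n : ℝ) ^ (α / (nodeDim p - 1))) ≤
        throughput δ Pmax κ (B n) (fun _ => C) ω) ∧
      (0 < α → ∀ ε > 0, ∀ᶠ n : ℕ in atTop, ∀ ω ∉ bad n,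
        (1 - ε) * (n : ℝ) ^ 2 ≤ (joinedPairs δ Pmax κ (B n) ω).ncard) := by
  obtain ⟨c, hc, hB⟩ := hB
  have hbal := tendsto_networkLaw_not_balanced hp₀ hp₁ hpr₀ hpr₁
  have hθ : 0 < nodeDim p - 1 := by linarith
  have hB₀ : ∀ᶠ n : ℕ in atTop, 0 ≤ B n := by
    filter_upwards [hB] with n hn
    refine le_trans ?_ hn
    cases κ <;> simp only [budgetOrder] <;> positivity
  -- For α ≤ 0 the power of n is at most 1, and a constant lower bound on balanced configurations is
  -- enough.
  rcases le_or_gt α 0 with hα₀ | hα₀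
  · refine ⟨_, p / 40, by positivity, hbal, ?_, fun h => absurd h hα₀.not_gt⟩
    filter_upwards [hB₀, eventually_ge_atTop 1] with n hBn hn C hC ω hω
    refine le_trans ?_ ((not_not.1 hω).le_throughput hp₀ hPmax.le hBn hn hC.le)
    gcongr
    refine mul_le_of_le_one_right hC.le (Real.rpow_le_one_of_one_le_of_nonpos ?_ ?_)
    · exact_mod_cast hn
    · exact div_nonpos_of_nonpos_of_nonneg hα₀ hθ.le
  · obtain ⟨K, hK, haff⟩ := exists_affordable (α := α) (κ := κ) hδ hPmax hc
    obtain ⟨L, hLtop, ⟨A, hA, hLA⟩, htyp⟩ :=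
      exists_typical hp₀ hp₁ hpr₀ hpr₁ hdF hdr hα₀ hα hK
    refine ⟨_, p / 288 / A, by positivity, tendsto_measure_union_zero htyp hbal, ?_, ?_⟩
    · filter_upwards [hB₀, hB, hLA, eventually_gt_atTop 0] with n hBn hBn' hLn hn C hC ω hω
      rw [Set.mem_union, not_or] at hω
      have hn0 : (0 : ℝ) < n := by exact_mod_cast hn
      refine le_trans ?_ ((not_not.1 hω.1).le_throughput (not_not.1 hω.2) hp₀ hPmax.le
        (by linarith) (by positivity) (haff n hn _ hBn') hBn hLn.2 hC.le)
      calc p / 288 / A * (C * (n : ℝ) ^ (α / (nodeDim p - 1)))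
          ≤ p / 288 / A * (C * (A * 2 ^ L n)) := by gcongr; exact hLn.1
        _ = p / 288 * C * 2 ^ L n := by field_simp
    · intro _ ε hε
      have hlim : Tendsto (fun n : ℕ => 2 / (2 : ℝ) ^ L n) atTop (𝓝 0) :=
        ((tendsto_pow_atTop_atTop_of_one_lt one_lt_two).comp hLtop).const_div_atTop 2
      filter_upwards [hB, eventually_gt_atTop 0, hlim.eventually_le_const hε]
        with n hBn hn hLn ω hω
      rw [Set.mem_union, not_or] at hω
      have hn0 : (0 : ℝ) < n := by exact_mod_cast hn
      refine le_trans ?_ ((not_not.1 hω.1).le_ncard_joinedPairs hPmax.le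
        (by linarith) (by positivity) (haff n hn _ hBn))
      gcongr

end Main

end Hyperfractal

open Hyperfractal in
theorem mainTheorem6 (p pr δ Pmax α : ℝ)
    (hp₀ : 0 < p) (hp₁ : p < 1) (hpr₀ : 0 < pr) (hpr₁ : pr < 1)
    (hδ : 2 ≤ δ) (hPmax : 0 < Pmax) (hα : α < 1)
    (hdF : 3 < nodeDim p) (hdr : relayDim pr < nodeDim p - 1)
    (κ : Criterion) (B : ℕ → ℝ)
    (hB_upper : B =O[atTop] budgetOrder δ Pmax α κ)
    (hB_lower : ∃ c > 0, ∀ᶠ n in atTop, c * budgetOrder δ Pmax α κ n ≤ B n) :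
    (∃ c > 0, ∀ C > 0,
      Tendsto (fun n : ℕ => networkLaw p pr n
        {ω | throughput δ Pmax κ (B n) (fun _ => C) ω <
          c * (C * (n : ℝ) ^ (α / (nodeDim p - 1)))}) atTop (𝓝 0) ∧
      ∀ᶠ n : ℕ in atTop,
        ENNReal.ofReal (c * (C * (n : ℝ) ^ (α / (nodeDim p - 1)))) ≤
          ∫⁻ ω, ENNReal.ofReal (throughput δ Pmax κ (B n) (fun _ => C) ω)
            ∂(networkLaw p pr n)) ∧
    (0 < α → ∀ ε > 0,
      Tendsto (fun n : ℕ => networkLaw p pr n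
        {ω | ((joinedPairs δ Pmax κ (B n) ω).ncard : ℝ) < (1 - ε) * (n : ℝ) ^ 2})
        atTop (𝓝 0)) := by
  obtain ⟨bad, c, hc, hbad, hthr, hjoin⟩ := exists_throughput_bound hp₀ hp₁ hpr₀ hpr₁ hδ hPmax hα
    hdF hdr κ B hB_lower
  have hprob : ∀ n, IsProbabilityMeasure (networkLaw p pr n) := fun n =>
    isProbabilityMeasure_networkLaw hp₀ hp₁
  refine ⟨⟨c / 2, by positivity, fun C hC => ?_⟩, fun hα₀ ε hε => ?_⟩
  · have h := tendsto_and_eventually_le_lintegral hbad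
      (f := fun n => throughput δ Pmax κ (B n) fun _ => C)
      (v := fun n => c * (C * (n : ℝ) ^ (α / (nodeDim p - 1)))) (fun n => by positivity)
      (by filter_upwards [hthr] with n hn using hn C hC)
    simpa only [mul_div_right_comm] using h
  · refine tendsto_of_tendsto_of_tendsto_of_le_of_le' tendsto_const_nhds hbad
      (Eventually.of_forall fun _ => zero_le) ?_
    filter_upwards [hjoin hα₀ ε hε] with n hn
    refine measure_mono fun ω hω => ?_
    by_contra hno
    exact absurd (hn ω hno) (not_le.2 hω)
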